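/- Theorem 2.2. Fix $n\ge 1$. A standard kernel with constants $A$ and $\varepsilon>0$ is a locally integrable function $K$, defined off the diagonal of $\mathbb{R}^n\times\mathbb{R}^n$, complex-valued, with $|K(x,y)|\le A|x-y|^{-n}$ for $x\ne y$ and $$|K(x,y)-K(z,y)|+|K(y,x)-K(y,z)|\le A\,\frac{|x-z|^{\varepsilon}}{|x-y|^{n+\varepsilon}}\quad\text{whenever } 2|x-z|<|x-y|.$$ A linear operator $T:C_c^\infty(\mathbb{R}^n)\to L^1_{loc}(\mathbb{R}^n)$ is a Calderón–Zygmund operator with kernel $K$ if $K$ is a standard kernel, $T$ extends to a bounded operator on $L^2(\mathbb{R}^n)$, and for every $\varphi\in C_c^\infty(\mathbb{R}^n)$ one has $T\varphi(x)=\int_{\mathbb{R}^n}K(x,y)\varphi(y)\,dy$ for almost every $x\notin\operatorname{supp}\varphi$. Its maximal singular integral operator is $$T^*f(x)=\sup_{\delta>0}\Big|\int_{|x-y|>\delta}K(x,y)f(y)\,dy\Big|,$$ and $Mf(x)=\sup_{Q\ni x}\frac1{|Q|}\int_Q|f(y)|\,dy$ is the Hardy–Littlewood maximal function, the supremum being over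 all cubes $Q$ (with sides parallel to the axes) that contain $x$. Let $A,B\in\mathbb{R}$ and $\varepsilon>0$. Then there are constants $c,\alpha>0$, depending only on $n$, $A$, $\varepsilon$ and $B$, such that for every Calderón–Zygmund operator $T$ on $\mathbb{R}^n$ whose kernel has constants $A,\varepsilon$ and whose extension to $L^2(\mathbb{R}^n)$ has norm at most $B$, every closed cube $Q\subset\mathbb{R}^n$ of positive side length, and every $f\in L^\infty(\mathbb{R}^n)$ that vanishes almost everywhere outside $Q$, $$|\{x\in Q: T^*f(x)>t\,Mf(x)\}|\le c\,e^{-\alpha t}\,|Q|,\qquad t>0.$$ -/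

import Mathlib

open MeasureTheory
open scoped ENNReal Distributions

/-- `ℝⁿ` with its Euclidean norm. -/
abbrev Rn (n : ℕ) : Type := EuclideanSpace ℝ (Fin n)

/-- The space `C_c^∞(ℝⁿ)` of complex-valued smooth compactly supported functions. -/
abbrev SmoothCc (n : ℕ) : Type := 𝓓((⊤ : TopologicalSpace.Opens (Rn n)), ℂ)

/-- The closed axis-parallel cube with lower corner `a` and side length `ℓ`. -/
def cube {n : ℕ} (a : Rn n) (ℓ : ℝ) : Set (Rn n) :=
  {x | ∀ i, x i ∈ Set.Icc (a i) (a i + ℓ)}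

/-- The (uncentred) Hardy--Littlewood maximal function: the supremum of the averages of `|f|` over
all cubes that contain `x`. -/
noncomputable def hlMaximal {n : ℕ} (f : Rn n → ℂ) (x : Rn n) : ℝ≥0∞ :=
  ⨆ (a : Rn n) (ℓ : ℝ) (_ : 0 < ℓ) (_ : x ∈ cube a ℓ), ⨍⁻ y in cube a ℓ, ‖f y‖ₑ ∂volume

/-- `K` is a standard kernel on `ℝⁿ × ℝⁿ` minus the diagonal, with constant `A` in the size and
regularity estimates and regularity exponent `ε`. The values `K x x` play no role. -/
structure IsStandardKernel {n : ℕ} (K : Rn n → Rn n → ℂ) (A ε : ℝ) : Prop where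
  locallyIntegrable :
    LocallyIntegrableOn (fun p : Rn n × Rn n => K p.1 p.2) {p | p.1 ≠ p.2}
  size : ∀ x y, x ≠ y → ‖K x y‖ ≤ A / ‖x - y‖ ^ n
  regularity : ∀ x y z, 2 * ‖x - z‖ < ‖x - y‖ →
    ‖K x y - K z y‖ + ‖K y x - K y z‖ ≤ A * ‖x - z‖ ^ ε / ‖x - y‖ ^ ((n : ℝ) + ε)

/-- The linear operator `T : C_c^∞(ℝⁿ) → L¹_loc(ℝⁿ)` is a Calderón--Zygmund operator with kernel
`K`; the kernel constants are `A` and `ε`, and `B` bounds the norm of `T` on `L²(ℝⁿ)`. Elements of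
`L¹_loc` are classes of functions modulo equality almost everywhere. -/
structure IsCalderonZygmund {n : ℕ} (T : SmoothCc n →ₗ[ℂ] (Rn n →ₘ[volume] ℂ))
    (K : Rn n → Rn n → ℂ) (A ε B : ℝ) : Prop where
  locallyIntegrable : ∀ φ : SmoothCc n, LocallyIntegrable (T φ) volume
  extends_L2 : ∃ S : Lp ℂ 2 (volume : Measure (Rn n)) →L[ℂ] Lp ℂ 2 (volume : Measure (Rn n)),
    ‖S‖ ≤ B ∧ ∀ (φ : SmoothCc n) (g : Lp ℂ 2 (volume : Measure (Rn n))),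
      g =ᵐ[volume] φ → S g =ᵐ[volume] T φ
  kernel : IsStandardKernel K A ε
  representation : ∀ φ : SmoothCc n, ∀ᵐ x, x ∉ tsupport φ → T φ x = ∫ y, K x y * φ y

/-- The truncated singular integral `∫_{|x - y| > δ} K(x, y) f(y) dy`. -/
noncomputable def truncatedIntegral {n : ℕ} (K : Rn n → Rn n → ℂ) (δ : ℝ) (f : Rn n → ℂ)
    (x : Rn n) : ℂ :=
  ∫ y in {y | δ < ‖x - y‖}, K x y * f y

/-- The maximal singular integral `T^* f(x) = sup_{δ > 0} |T_δ f(x)|` of the operator with kernel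
`K`, with values in `[0, ∞]`. -/
noncomputable def maximalSingularIntegral {n : ℕ} (K : Rn n → Rn n → ℂ) (f : Rn n → ℂ)
    (x : Rn n) : ℝ≥0∞ :=
  ⨆ (δ : ℝ) (_ : 0 < δ), ‖truncatedIntegral K δ f x‖ₑ

/-! The proof is an iteration of John–Nirenberg type resting on the weak type (1,1) of the maximal
singular integral `T^*`. Let `F'` be the restriction of the function to a ball `P` comparable with
the cube `Q`, and let `μ` be the mean of `|F'|` over the cube circumscribed about `P`. By the
weak-type bounds, the set `E` where `T^* F' > 3Λμ` or `M F' > Λμ` is a small fraction of `|Q|` once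
`Λ` is large. `exists_cubes_of_volume_le` covers almost all of `E` by cubes of total volume at most
`|Q| / 2`, each containing some `x' ∉ E`. On such a cube `q`, the part of `F'` far from `q`
contributes at most `T^* F'(x') + C M F'(x')` (`IsStandardKernel.maximalSingularIntegral_far_le`),
which is a multiple of `μ`, and `μ ≤ M F'(x)` for every `x ∈ Q`. So where `T^* F'` exceeds `k + 1`
units of the maximal function, the part of `F'` near `q` still exceeds `k` units. Each restart on
the cubes `q` halves the measure (`volume_stepConst_mul_maxFn_lt_le`). Truncation only decreases the
maximal function, so every stage can be compared with the original one.

The weak-type bound comes from `L²`. Cotlar's inequality (`maximalSingularIntegral_sq_le`) compares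
a truncated integral at `x` with values of the `L²` operator at nearby points and averages the
squares over a small cube; only the `L²` bound enters. This gives weak type (2,2), and the
Calderón–Zygmund decomposition turns it into weak type (1,1). Both steps apply the operator to rough
functions, so the kernel formula is first extended from test functions by density
(`IsCalderonZygmund.exists_representedBy`). -/

/-- The half-open axis-parallel cube with lower corner `a` and side length `ℓ`. -/
def ocube {n : ℕ} (a : Rn n) (ℓ : ℝ) : Set (Rn n) :=
  {x | ∀ i, x i ∈ Set.Ico (a i) (a i + ℓ)}

/-- The closed cube with centre `c` and half side length `r`. -/
noncomputable def centredCube {n : ℕ} (c : Rn n) (r : ℝ) : Set (Rn n) :=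
  cube (c - WithLp.toLp 2 (fun _ => r)) (2 * r)

/-- The uncentred maximal function of a nonnegative function, over cubes. -/
noncomputable def maxFn {n : ℕ} (u : Rn n → ℝ≥0∞) (x : Rn n) : ℝ≥0∞ :=
  ⨆ (a : Rn n) (ℓ : ℝ) (_ : 0 < ℓ) (_ : x ∈ cube a ℓ), ⨍⁻ y in cube a ℓ, u y ∂volume

/-! ### Cubes, balls and the Hardy–Littlewood maximal function -/

section geometry

variable {n : ℕ}

/-- The argument runs with `maxFn` because Cotlar's inequality also needs the maximal function of
squares; this is the link back to the theorem. -/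
lemma hlMaximal_eq_maxFn (f : Rn n → ℂ) (x : Rn n) :
    hlMaximal f x = maxFn (fun y => ‖f y‖ₑ) x := rfl

lemma ocube_subset_cube (a : Rn n) (ℓ : ℝ) : ocube a ℓ ⊆ cube a ℓ :=
  fun _ hx i => Set.Ico_subset_Icc_self (hx i)

lemma mem_centredCube {c x : Rn n} {r : ℝ} : x ∈ centredCube c r ↔ ∀ i, |x i - c i| ≤ r := by
  refine forall_congr' fun i => ?_
  simp only [PiLp.sub_apply, Set.mem_Icc, abs_le]
  constructor <;> rintro ⟨h₁, h₂⟩ <;> constructor <;> linarith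

lemma cube_eq_preimage (a : Rn n) (ℓ : ℝ) :
    cube a ℓ = WithLp.ofLp ⁻¹' (Set.pi Set.univ fun i => Set.Icc (a i) (a i + ℓ)) := by
  ext x; simp only [cube, Set.mem_preimage, Set.mem_univ_pi]; rfl

lemma ocube_eq_preimage (a : Rn n) (ℓ : ℝ) :
    ocube a ℓ = WithLp.ofLp ⁻¹' (Set.pi Set.univ fun i => Set.Ico (a i) (a i + ℓ)) := by
  ext x; simp only [ocube, Set.mem_preimage, Set.mem_univ_pi]; rfl

lemma measurableSet_cube (a : Rn n) (ℓ : ℝ) : MeasurableSet (cube a ℓ) := by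
  rw [cube_eq_preimage]
  exact (PiLp.volume_preserving_ofLp (Fin n)).measurable
    (MeasurableSet.univ_pi fun i => measurableSet_Icc)

lemma measurableSet_ocube (a : Rn n) (ℓ : ℝ) : MeasurableSet (ocube a ℓ) := by
  rw [ocube_eq_preimage]
  exact (PiLp.volume_preserving_ofLp (Fin n)).measurable
    (MeasurableSet.univ_pi fun i => measurableSet_Ico)

lemma volume_cube (a : Rn n) (ℓ : ℝ) : volume (cube a ℓ) = ENNReal.ofReal ℓ ^ n := by
  rw [cube_eq_preimage, (PiLp.volume_preserving_ofLp (Fin n)).measure_preimage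
    (MeasurableSet.univ_pi fun i => measurableSet_Icc).nullMeasurableSet]
  simp [-Set.pi_univ_Icc, volume_pi_pi]

lemma volume_ocube (a : Rn n) (ℓ : ℝ) : volume (ocube a ℓ) = ENNReal.ofReal ℓ ^ n := by
  rw [ocube_eq_preimage, (PiLp.volume_preserving_ofLp (Fin n)).measure_preimage
    (MeasurableSet.univ_pi fun i => measurableSet_Ico).nullMeasurableSet]
  simp [volume_pi_pi]

lemma abs_coord_le_norm (x : Rn n) (i : Fin n) : |x i| ≤ ‖x‖ := by
  simpa using PiLp.norm_apply_le x i

lemma norm_le_of_coord {x : Rn n} {s : ℝ} (h : ∀ i, |x i| ≤ s) : ‖x‖ ≤ n * s := by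
  rcases Nat.eq_zero_or_pos n with rfl | hn
  · simp [Subsingleton.elim x 0]
  have hs : 0 ≤ s := (abs_nonneg _).trans (h ⟨0, hn⟩)
  have hn1 : (1 : ℝ) ≤ n := by exact_mod_cast hn
  rw [EuclideanSpace.norm_eq]
  apply Real.sqrt_le_iff.2 ⟨by positivity, ?_⟩
  calc ∑ i, ‖x i‖ ^ 2 ≤ ∑ _i : Fin n, s ^ 2 := by
        gcongr with i; exact h i
    _ = n * s ^ 2 := by simp
    _ ≤ (n * s) ^ 2 := by nlinarith [mul_nonneg (sub_nonneg.2 hn1) (sq_nonneg s)]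

lemma norm_sub_le_of_mem_cube {a x y : Rn n} {ℓ : ℝ} (hx : x ∈ cube a ℓ) (hy : y ∈ cube a ℓ) :
    ‖x - y‖ ≤ n * ℓ := by
  refine norm_le_of_coord fun i => ?_
  have h₁ := hx i; have h₂ := hy i
  simp only [Set.mem_Icc] at h₁ h₂
  rw [PiLp.sub_apply, abs_le]; constructor <;> linarith

lemma closedBall_subset_centredCube (c : Rn n) (r : ℝ) :
    Metric.closedBall c r ⊆ centredCube c r := by
  intro x hx
  rw [mem_centredCube]
  intro i
  rw [Metric.mem_closedBall, dist_eq_norm] at hx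
  exact (abs_coord_le_norm (x - c) i).trans hx

lemma volume_centredCube (c : Rn n) (r : ℝ) :
    volume (centredCube c r) = ENNReal.ofReal (2 * r) ^ n := volume_cube _ _

/-- The integral over a cube is controlled by the maximal function at any of its points. -/
lemma setLIntegral_cube_le (u : Rn n → ℝ≥0∞) {a x : Rn n} {ℓ : ℝ} (hℓ : 0 < ℓ)
    (hx : x ∈ cube a ℓ) : ∫⁻ y in cube a ℓ, u y ≤ ENNReal.ofReal ℓ ^ n * maxFn u x := by
  have h : ⨍⁻ y in cube a ℓ, u y ∂volume ≤ maxFn u x :=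
    le_iSup_of_le a (le_iSup_of_le ℓ (le_iSup_of_le hℓ (le_iSup_of_le hx le_rfl)))
  have h0 : ENNReal.ofReal ℓ ^ n ≠ 0 := pow_ne_zero _ (by simpa using hℓ)
  have h1 : ENNReal.ofReal ℓ ^ n ≠ ∞ := ENNReal.pow_ne_top ENNReal.ofReal_ne_top
  rw [setLAverage_eq, volume_cube] at h
  rw [mul_comm]
  exact (ENNReal.div_le_iff h0 h1).1 h

lemma setLIntegral_closedBall_le (u : Rn n → ℝ≥0∞) {c p : Rn n} {r : ℝ} (hr : 0 < r)
    (hp : ‖p - c‖ ≤ r) :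
    ∫⁻ y in Metric.closedBall c r, u y ≤ ENNReal.ofReal (2 * r) ^ n * maxFn u p :=
  (lintegral_mono_set (closedBall_subset_centredCube c r)).trans
    (setLIntegral_cube_le u (by positivity)
      (closedBall_subset_centredCube c r (by simpa [dist_eq_norm] using hp)))

lemma maxFn_mono {u v : Rn n → ℝ≥0∞} (h : ∀ᵐ x, u x ≤ v x) (x : Rn n) :
    maxFn u x ≤ maxFn v x := by
  refine iSup_mono fun a => iSup_mono fun ℓ => iSup_mono fun _ => iSup_mono fun _ => ?_
  rw [setLAverage_eq, setLAverage_eq]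
  gcongr 1
  exact lintegral_mono_ae (ae_restrict_of_ae h)

lemma maxFn_le_of_forall {u : Rn n → ℝ≥0∞} {x : Rn n} {B : ℝ≥0∞}
    (h : ∀ (a : Rn n) (ℓ : ℝ), 0 < ℓ → x ∈ cube a ℓ →
      ∫⁻ y in cube a ℓ, u y ≤ B * ENNReal.ofReal ℓ ^ n) : maxFn u x ≤ B := by
  refine iSup_le fun a => iSup_le fun ℓ => iSup_le fun hℓ => iSup_le fun hx => ?_
  rw [setLAverage_eq, volume_cube]
  exact ENNReal.div_le_of_le_mul (h a ℓ hℓ hx)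

lemma maxFn_const_le (B : ℝ≥0∞) (x : Rn n) : maxFn (fun _ => B) x ≤ B :=
  maxFn_le_of_forall fun a ℓ _ _ => by simp [volume_cube]

/-- The weak-type `(1,1)` inequality for the maximal function. -/
theorem mul_volume_lt_maxFn_le (hn : 1 ≤ n) (u : Rn n → ℝ≥0∞) (lam : ℝ≥0∞) :
    lam * volume {x | lam < maxFn u x} ≤ 5 ^ n * ∫⁻ x, u x := by
  rcases eq_or_ne lam 0 with rfl | h0
  · simp
  rcases eq_or_ne lam ∞ with rfl | htop
  · simp
  by_cases hI : ∫⁻ x, u x = ∞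
  · rw [hI, ENNReal.mul_top (by positivity)]; exact le_top
  set t : Set (Rn n × ℝ) :=
    {q | 0 < q.2 ∧ lam * ENNReal.ofReal q.2 ^ n < ∫⁻ y in cube q.1 q.2, u y} with ht
  -- Vitali's lemma needs bounded sides. Cubes in `t` have volume less than the total integral over
  -- `lam`, and `ℓ ≤ ℓ ^ n` once `ℓ ≥ 1`.
  have hbound : ∀ q ∈ t, q.2 ≤ max 1 ((∫⁻ x, u x) / lam).toReal := by
    rintro ⟨a, ℓ⟩ ⟨hℓ, hq⟩
    simp only at hℓ hq ⊢
    rcases le_total ℓ 1 with h1 | h1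
    · exact le_max_of_le_left h1
    refine le_max_of_le_right ?_
    have h2 : ENNReal.ofReal ℓ ≤ (∫⁻ x, u x) / lam := by
      rw [ENNReal.le_div_iff_mul_le (Or.inl h0) (Or.inl htop), mul_comm]
      refine le_trans ?_ (hq.le.trans (setLIntegral_le_lintegral _ _))
      gcongr
      exact le_self_pow₀ (by simpa using h1) (by omega)
    exact (ENNReal.ofReal_le_iff_le_toReal (ENNReal.div_ne_top hI h0)).1 h2
  have hint : ∀ q ∈ t, (interior (cube q.1 q.2)).Nonempty := by
    rintro ⟨a, ℓ⟩ ⟨hℓ, -⟩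
    refine ⟨a + WithLp.toLp 2 (fun _ => ℓ / 2), ?_⟩
    rw [mem_interior_iff_mem_nhds]
    refine Filter.mem_of_superset (Metric.closedBall_mem_nhds _ (half_pos hℓ)) ?_
    refine (closedBall_subset_centredCube _ _).trans fun x hx i => ?_
    have := abs_le.1 (mem_centredCube.1 hx i)
    simp only [PiLp.add_apply] at this
    constructor <;> linarith [this.1, this.2]
  obtain ⟨s, hst, hdisj, hcov⟩ := Vitali.exists_disjoint_subfamily_covering_enlargement
    (fun q : Rn n × ℝ => cube q.1 q.2) t (fun q => q.2) 2 one_lt_two (fun q hq => hq.1.le) _ hbound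
    (fun q hq => (hint q hq).mono interior_subset)
  have hsc : s.Countable := hdisj.countable_of_nonempty_interior fun q hq => hint q (hst hq)
  -- A cube of `t` meets a selected cube of at least half its side, so it stays within `2 * q.2` of
  -- it in each coordinate. This gives the side `5 = 1 + 2 + 2`.
  have hsub : {x | lam < maxFn u x} ⊆
      ⋃ q ∈ s, cube (q.1 - WithLp.toLp 2 (fun _ => 2 * q.2)) (5 * q.2) := by
    intro x hx
    simp only [Set.mem_ofPred_eq, maxFn, lt_iSup_iff] at hx
    obtain ⟨a, ℓ, hℓ, hxa, hx⟩ := hx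
    rw [setLAverage_eq, volume_cube, ENNReal.lt_div_iff_mul_lt
      (Or.inl (pow_ne_zero _ (by simpa using hℓ))) (Or.inl (by finiteness))] at hx
    obtain ⟨q, hq, ⟨z, hz₁, hz₂⟩, hle⟩ := hcov (a, ℓ) ⟨hℓ, hx⟩
    simp only at hz₁ hz₂ hle
    refine Set.mem_biUnion hq fun i => ?_
    have h₁ := hz₁ i; have h₂ := hz₂ i; have h₃ := hxa i
    simp only [Set.mem_Icc, PiLp.sub_apply] at h₁ h₂ h₃ ⊢
    constructor <;> linarith [h₁.1, h₁.2, h₂.1, h₂.2, h₃.1, h₃.2]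
  calc lam * volume {x | lam < maxFn u x}
      ≤ lam * ∑' q : s, ENNReal.ofReal (5 * q.1.2) ^ n := by
        gcongr
        refine (measure_mono hsub).trans ((measure_biUnion_le volume hsc _).trans ?_)
        simp [volume_cube]
    _ = ∑' q : s, 5 ^ n * (lam * ENNReal.ofReal q.1.2 ^ n) := by
        rw [← ENNReal.tsum_mul_left]
        congr with q
        rw [ENNReal.ofReal_mul (by norm_num), mul_pow]
        simp only [ENNReal.ofReal_ofNat]
        ring
    _ ≤ ∑' q : s, 5 ^ n * ∫⁻ y in cube q.1.1 q.1.2, u y := by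
        gcongr with q
        exact (hst q.2).2.le
    _ = 5 ^ n * ∫⁻ y in ⋃ q ∈ s, cube q.1 q.2, u y := by
        rw [ENNReal.tsum_mul_left, lintegral_biUnion hsc (fun q _ => measurableSet_cube _ _) hdisj]
    _ ≤ 5 ^ n * ∫⁻ x, u x := by
        gcongr; exact Measure.restrict_le_self

/-- The constant in the decay estimate `setLIntegral_decay_le`. -/
noncomputable def decayConst (n : ℕ) (ε : ℝ) : ℝ≥0∞ :=
  4 ^ n * (1 - ENNReal.ofReal (2 ^ (-ε)))⁻¹

lemma decayConst_ne_top (n : ℕ) {ε : ℝ} (hε : 0 < ε) : decayConst n ε ≠ ∞ := by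
  refine ENNReal.mul_ne_top (by finiteness) (ENNReal.inv_ne_top.2 ?_)
  rw [Ne, tsub_eq_zero_iff_le, not_le, ENNReal.ofReal_lt_one]
  exact Real.rpow_lt_one_of_one_lt_of_neg one_lt_two (by linarith)

/-- Integration against the tail `r ^ ε / |x - y| ^ (n + ε)` is controlled by the maximal
function. -/
theorem setLIntegral_decay_le (u : Rn n → ℝ≥0∞) {ε : ℝ} (hε : 0 < ε) {r : ℝ} (hr : 0 < r)
    {x p : Rn n} (hp : ‖p - x‖ ≤ r) :
    ∫⁻ y in {y | r < ‖x - y‖}, ENNReal.ofReal (r ^ ε / ‖x - y‖ ^ ((n : ℝ) + ε)) * u y ≤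
      decayConst n ε * maxFn u p := by
  have hmeas : Measurable fun y : Rn n => ‖x - y‖ := by fun_prop
  have hsub : {y : Rn n | r < ‖x - y‖} ⊆
      ⋃ k : ℕ, {y | 2 ^ k * r < ‖x - y‖ ∧ ‖x - y‖ ≤ 2 ^ (k + 1) * r} := by
    intro y hy
    simp only [Set.mem_ofPred_eq, Set.mem_iUnion] at hy ⊢
    obtain ⟨k, hk⟩ := exists_nat_pow_near (x := ‖x - y‖ / r) (y := 2)
      ((one_le_div hr).2 hy.le) one_lt_two
    by_cases h : 2 ^ k * r < ‖x - y‖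
    · exact ⟨k, h, ((div_lt_iff₀ hr).1 hk.2).le⟩
    -- The shells are open on the inside, so a point on a dyadic sphere belongs to the previous
    -- shell; `k = 0` is excluded by `r < ‖x - y‖`.
    · have heq : ‖x - y‖ = 2 ^ k * r := le_antisymm (not_lt.1 h) ((le_div_iff₀ hr).1 hk.1)
      obtain _ | k := k
      · simp at heq; linarith
      · refine ⟨k, ?_, heq.le⟩
        rw [heq, pow_succ]
        nlinarith [pow_pos (two_pos (α := ℝ)) k, mul_pos (pow_pos (two_pos (α := ℝ)) k) hr]
  have hterm : ∀ k : ℕ, ∫⁻ y in {y | 2 ^ k * r < ‖x - y‖ ∧ ‖x - y‖ ≤ 2 ^ (k + 1) * r},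
      ENNReal.ofReal (r ^ ε / ‖x - y‖ ^ ((n : ℝ) + ε)) * u y ≤
      4 ^ n * ENNReal.ofReal (2 ^ (-ε)) ^ k * maxFn u p := by
    intro k
    have hR : 0 < 2 ^ k * r := by positivity
    -- The weight at the inner radius of the shell. The power of the radius cancels the volume of
    -- the ball and leaves a geometric series in `2 ^ (-ε)`.
    set c : ℝ := (2 ^ (-ε)) ^ k / (2 ^ k * r) ^ n with hc
    have hcR : r ^ ε / (2 ^ k * r) ^ ((n : ℝ) + ε) = c := by
      rw [Real.rpow_add hR, Real.rpow_natCast, Real.mul_rpow (by positivity) hr.le, hc,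
        Real.rpow_neg (by norm_num), inv_pow, ← Real.rpow_natCast (2 ^ ε) k,
        ← Real.rpow_natCast 2 k, ← Real.rpow_mul (by norm_num), ← Real.rpow_mul (by norm_num),
        mul_comm ε k]
      have : 0 < r ^ ε := by positivity
      field_simp
    calc _ ≤ ∫⁻ y in {y | 2 ^ k * r < ‖x - y‖ ∧ ‖x - y‖ ≤ 2 ^ (k + 1) * r},
          ENNReal.ofReal c * u y := by
          refine setLIntegral_mono' ((measurableSet_lt measurable_const hmeas).inter
            (measurableSet_le hmeas measurable_const)) fun y hy => ?_
          gcongr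
          rw [← hcR]
          have := hy.1
          gcongr
      _ = ENNReal.ofReal c * ∫⁻ y in {y | 2 ^ k * r < ‖x - y‖ ∧ ‖x - y‖ ≤ 2 ^ (k + 1) * r}, u y :=
          lintegral_const_mul' _ _ ENNReal.ofReal_ne_top
      _ ≤ ENNReal.ofReal c * (ENNReal.ofReal (2 * (2 ^ (k + 1) * r)) ^ n * maxFn u p) := by
          gcongr
          refine le_trans (lintegral_mono_set fun y hy => ?_) (setLIntegral_closedBall_le u
            (c := x) (by positivity) ?_)
          · rw [Metric.mem_closedBall, dist_comm, dist_eq_norm]; exact hy.2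
          · exact hp.trans (by nlinarith [one_le_pow₀ (one_le_two (α := ℝ)) (n := k + 1)])
      _ = _ := by
          rw [← mul_assoc, ← ENNReal.ofReal_pow (by positivity), ← ENNReal.ofReal_mul
            (by positivity), ← ENNReal.ofReal_pow (by positivity)]
          have h4 : (4 : ℝ≥0∞) ^ n = ENNReal.ofReal (4 ^ n) := by
            rw [ENNReal.ofReal_pow (by norm_num)]; simp
          rw [h4, ← ENNReal.ofReal_mul (by positivity)]
          congr 2
          rw [hc, pow_succ, show 2 * (2 ^ k * 2 * r) = 4 * (2 ^ k * r) by ring, mul_pow 4]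
          field_simp
  calc _ ≤ _ := lintegral_mono_set hsub
    _ ≤ _ := lintegral_iUnion_le _ _
    _ ≤ ∑' k : ℕ, 4 ^ n * ENNReal.ofReal (2 ^ (-ε)) ^ k * maxFn u p := ENNReal.tsum_le_tsum hterm
    _ = _ := by
      rw [ENNReal.tsum_mul_right, ENNReal.tsum_mul_left, ENNReal.tsum_geometric, decayConst]

end geometry

/-! ### Dyadic grids, Lebesgue differentiation and stopping cubes -/

section decomposition

variable {n : ℕ}

lemma ocube_ae_eq_cube (a : Rn n) (ℓ : ℝ) : ocube a ℓ =ᵐ[volume] cube a ℓ :=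
  ae_eq_of_subset_of_measure_ge (ocube_subset_cube a ℓ) (by rw [volume_cube, volume_ocube])
    (measurableSet_ocube a ℓ).nullMeasurableSet (by rw [volume_cube]; finiteness)

/-- The index of the dyadic cube of side `ℓ / 2 ^ k` containing `x`. -/
noncomputable def gridIdx (ℓ : ℝ) (k : ℕ) (x : Rn n) : Fin n → ℤ :=
  fun i => ⌊2 ^ k * x i / ℓ⌋

/-- The lower corner of the dyadic cube of side `ℓ / 2 ^ k` with index `m`. -/
noncomputable def gridCorner (ℓ : ℝ) (k : ℕ) (m : Fin n → ℤ) : Rn n :=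
  WithLp.toLp 2 fun i => ℓ / 2 ^ k * m i

lemma mem_gridCell {ℓ : ℝ} (hℓ : 0 < ℓ) {k : ℕ} {m : Fin n → ℤ} {x : Rn n} :
    x ∈ ocube (gridCorner ℓ k m) (ℓ / 2 ^ k) ↔ gridIdx ℓ k x = m := by
  rw [funext_iff]
  refine forall_congr' fun i => ?_
  have h2 : (0 : ℝ) < 2 ^ k := by positivity
  rw [gridIdx, Int.floor_eq_iff, le_div_iff₀ hℓ, div_lt_iff₀ hℓ, gridCorner, Set.mem_Ico]
  simp only
  rw [div_mul_eq_mul_div, div_le_iff₀ h2, ← add_div, lt_div_iff₀ h2]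
  constructor <;> rintro ⟨h₁, h₂⟩ <;> constructor <;> linarith

/-- Halving the index with integer division gives the index of the parent cell, so the grids are
nested. -/
lemma gridIdx_succ (ℓ : ℝ) (k : ℕ) (x : Rn n) (i : Fin n) :
    gridIdx ℓ k x i = gridIdx ℓ (k + 1) x i / 2 := by
  unfold gridIdx
  set t := 2 ^ k * x i / ℓ with ht
  have h2 : 2 ^ (k + 1) * x i / ℓ = 2 * t := by rw [ht, pow_succ]; ring
  rw [h2, Int.floor_eq_iff]
  have h₁ := Int.floor_le (2 * t)
  have h₂ := Int.lt_floor_add_one (2 * t)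
  have h₃ : (2 * (⌊2 * t⌋ / 2 : ℤ) : ℝ) ≤ ⌊2 * t⌋ := by
    exact_mod_cast (by lia : 2 * (⌊2 * t⌋ / 2) ≤ ⌊2 * t⌋)
  have h₄ : (⌊2 * t⌋ : ℝ) + 1 ≤ 2 * (⌊2 * t⌋ / 2 : ℤ) + 2 := by
    exact_mod_cast (by lia : ⌊2 * t⌋ + 1 ≤ 2 * (⌊2 * t⌋ / 2) + 2)
  constructor <;> linarith

lemma gridIdx_congr {ℓ : ℝ} {j k : ℕ} (hjk : j ≤ k) {x y : Rn n}
    (h : gridIdx ℓ k x = gridIdx ℓ k y) : gridIdx ℓ j x = gridIdx ℓ j y := by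
  induction k, hjk using Nat.le_induction with
  | base => exact h
  | succ k _ ih =>
    refine ih (funext fun i => ?_)
    rw [gridIdx_succ ℓ k x, gridIdx_succ ℓ k y, h]

/-- Lebesgue differentiation along the dyadic cubes containing a point. -/
lemma ae_tendsto_grid_average (hn : 1 ≤ n) {u : Rn n → ℝ≥0∞} (hu : AEMeasurable u volume)
    (hfin : ∫⁻ x, u x ≠ ∞) {ℓ : ℝ} (hℓ : 0 < ℓ) :
    ∀ᵐ x, Filter.Tendsto (fun k : ℕ =>
      (∫⁻ y in ocube (gridCorner ℓ k (gridIdx ℓ k x)) (ℓ / 2 ^ k), u y) /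
        ENNReal.ofReal (ℓ / 2 ^ k) ^ n) Filter.atTop (nhds (u x)) := by
  have hn1 : (1 : ℝ) ≤ n := by exact_mod_cast hn
  have hball : ∀ (x : Rn n) (r : ℝ), volume (Metric.closedBall x r) ≤
      ENNReal.ofReal (2 * r) ^ n := fun x r =>
    (measure_mono (closedBall_subset_centredCube x r)).trans (volume_centredCube x r).le
  -- For balls alone `3 ^ n` would do. The larger constant admits cubes into the Vitali family: a
  -- cube of side `s` lies in the ball of radius `n * s` about any of its points, and the ball of
  -- three times that radius has volume at most `(6 * n * s) ^ n`.
  have hdoub : ∀ x : Rn n, ∃ᶠ r in nhdsWithin 0 (Set.Ioi 0),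
      volume (Metric.closedBall x (3 * r)) ≤
        ((6 * n : NNReal) ^ n : NNReal) * volume (Metric.closedBall x r) := by
    intro x
    refine Filter.Eventually.frequently ?_
    filter_upwards [self_mem_nhdsWithin] with r hr
    rw [Measure.addHaar_closedBall_mul volume x (by norm_num) (le_of_lt hr),
      Measure.addHaar_closedBall_center volume x r, finrank_euclideanSpace_fin,
      ENNReal.ofReal_pow (by norm_num)]
    gcongr
    push_cast
    gcongr
    simp only [ENNReal.ofReal_ofNat]
    have : (3 : NNReal) ≤ 6 * n := by
      have : (1 : NNReal) ≤ n := by exact_mod_cast hn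
      calc (3 : NNReal) ≤ 6 * 1 := by norm_num
        _ ≤ 6 * n := by gcongr
    exact_mod_cast this
  have hv := (Vitali.vitaliFamily (volume : Measure (Rn n)) _ hdoub).ae_tendsto_lintegral_div hu hfin
  filter_upwards [hv] with x hx
  have hmem : ∀ k : ℕ, x ∈ cube (gridCorner ℓ k (gridIdx ℓ k x)) (ℓ / 2 ^ k) :=
    fun k => ocube_subset_cube _ _ ((mem_gridCell hℓ).2 rfl)
  have hsub : ∀ k : ℕ, cube (gridCorner ℓ k (gridIdx ℓ k x)) (ℓ / 2 ^ k) ⊆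
      Metric.closedBall x (n * (ℓ / 2 ^ k)) := fun k y hy => by
    rw [Metric.mem_closedBall, dist_eq_norm]
    exact norm_sub_le_of_mem_cube hy (hmem k)
  -- Vitali families consist of closed sets, so closed cells are used here; the half-open ones
  -- differ from them by null sets.
  have htend : Filter.Tendsto (fun k : ℕ => cube (gridCorner ℓ k (gridIdx ℓ k x)) (ℓ / 2 ^ k))
      Filter.atTop ((Vitali.vitaliFamily (volume : Measure (Rn n)) _ hdoub).filterAt x) := by
    rw [VitaliFamily.tendsto_filterAt_iff]
    refine ⟨Filter.Eventually.of_forall fun k => ⟨?_, ?_, n * (ℓ / 2 ^ k), hsub k, ?_⟩,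
      fun δ hδ => ?_⟩
    · rw [cube_eq_preimage]
      exact (isClosed_set_pi fun i _ => isClosed_Icc).preimage (PiLp.continuous_ofLp 2 _)
    · rw [cube_eq_preimage]
      have hc : Continuous (WithLp.ofLp : Rn n → Fin n → ℝ) := PiLp.continuous_ofLp 2 _
      have hpos : 0 < ℓ / 2 ^ k := by positivity
      refine Set.Nonempty.mono (preimage_interior_subset_interior_preimage hc) ?_
      rw [interior_pi_set Set.finite_univ]
      simp only [interior_Icc]
      refine ⟨WithLp.toLp 2 fun i => gridCorner ℓ k (gridIdx ℓ k x) i + ℓ / 2 ^ k / 2,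
        fun i _ => ⟨?_, ?_⟩⟩ <;> simp <;> linarith
    · refine (hball _ _).trans (le_of_eq ?_)
      rw [volume_cube, show 2 * (3 * (n * (ℓ / 2 ^ k))) = (6 * n : NNReal) * (ℓ / 2 ^ k) by
        push_cast; ring, ENNReal.ofReal_mul (by positivity), mul_pow, ENNReal.ofReal_coe_nnreal,
        ENNReal.coe_pow]
    · have : Filter.Tendsto (fun k : ℕ => n * (ℓ / 2 ^ k)) Filter.atTop (nhds 0) := by
        have h := tendsto_pow_atTop_nhds_zero_of_lt_one (r := (1 / 2 : ℝ)) (by norm_num)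
          (by norm_num)
        have h2 := h.const_mul (n * ℓ)
        rw [mul_zero] at h2
        refine h2.congr fun k => ?_
        rw [one_div, inv_pow]; ring
      filter_upwards [this.eventually (gt_mem_nhds hδ)] with k hk
      exact (hsub k).trans (Metric.closedBall_subset_closedBall hk.le)
  refine (hx.comp htend).congr fun k => ?_
  simp only [Function.comp_apply, volume_cube]
  rw [setLIntegral_congr (ocube_ae_eq_cube _ _)]

/-- The Calderón--Zygmund decomposition: the stopping cubes of `u` at height `lam`. -/
theorem exists_stopping_cubes (hn : 1 ≤ n) {u : Rn n → ℝ≥0∞} (hu : AEMeasurable u volume)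
    {lam : ℝ≥0∞} (htop : lam ≠ ∞) {ℓ : ℝ} (hℓ : 0 < ℓ)
    (hint : ∫⁻ x, u x ≤ lam * ENNReal.ofReal ℓ ^ n) :
    ∃ s : Set (Rn n × ℝ), s.Countable ∧ (∀ q ∈ s, 0 < q.2) ∧
      s.PairwiseDisjoint (fun q => ocube q.1 q.2) ∧
      (∀ q ∈ s, lam * ENNReal.ofReal q.2 ^ n < ∫⁻ y in ocube q.1 q.2, u y) ∧
      (∀ q ∈ s, ∫⁻ y in ocube q.1 q.2, u y ≤ 2 ^ n * (lam * ENNReal.ofReal q.2 ^ n)) ∧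
      ∀ᵐ x, x ∉ (⋃ q ∈ s, ocube q.1 q.2) → u x ≤ lam := by
  set cell : ℕ → (Fin n → ℤ) → Set (Rn n) := fun k m => ocube (gridCorner ℓ k m) (ℓ / 2 ^ k)
    with hcell
  set bad : ℕ → (Fin n → ℤ) → Prop := fun k m =>
    lam * ENNReal.ofReal (ℓ / 2 ^ k) ^ n < ∫⁻ y in cell k m, u y with hbad
  have hbad0 : ∀ m, ¬ bad 0 m := fun m => by
    simp only [hbad, pow_zero, div_one, not_lt]
    exact (setLIntegral_le_lintegral _ _).trans hint
  -- Bad cells without a bad ancestor. Maximality makes them disjoint, and the parent being good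
  -- gives the upper bound with the factor `2 ^ n`.
  set S : Set (ℕ × (Fin n → ℤ)) :=
    {p | bad p.1 p.2 ∧ ∀ x ∈ cell p.1 p.2, ∀ j < p.1, ¬ bad j (gridIdx ℓ j x)} with hS
  have hpos : ∀ k : ℕ, 0 < ℓ / 2 ^ k := fun k => by positivity
  refine ⟨(fun p : ℕ × (Fin n → ℤ) => (gridCorner ℓ p.1 p.2, ℓ / 2 ^ p.1)) '' S,
    S.to_countable.image _, ?_, ?_, ?_, ?_, ?_⟩
  · rintro _ ⟨p, -, rfl⟩
    exact hpos _
  · rintro _ ⟨⟨k, m⟩, hp, rfl⟩ _ ⟨⟨k', m'⟩, hp', rfl⟩ hne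
    refine Set.disjoint_left.2 fun x hx hx' => hne ?_
    simp only at hx hx'
    have h₁ := (mem_gridCell hℓ).1 hx
    have h₂ := (mem_gridCell hℓ).1 hx'
    rcases lt_trichotomy k k' with h | rfl | h
    · exact absurd (h₁ ▸ hp.1) (hp'.2 x hx' k h)
    · rw [← h₁, ← h₂]
    · exact absurd (h₂ ▸ hp'.1) (hp.2 x hx k' h)
  · rintro _ ⟨p, hp, rfl⟩
    exact hp.1
  · rintro _ ⟨⟨k, m⟩, hp, rfl⟩
    -- No cell of scale `0` is bad, by the bound on the total integral, so every stopping cell has a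
    -- parent in the grid.
    obtain _ | k := k
    · exact absurd hp.1 (hbad0 m)
    have hx : gridCorner ℓ (k + 1) m ∈ cell (k + 1) m := fun i => by
      simp [hpos (k + 1)]
    have hnb := hp.2 _ hx k (Nat.lt_succ_self k)
    simp only [hbad, not_lt] at hnb
    have hsub : cell (k + 1) m ⊆ cell k (gridIdx ℓ k (gridCorner ℓ (k + 1) m)) := fun y hy => by
      refine (mem_gridCell hℓ).2 (gridIdx_congr (Nat.le_succ k) ?_)
      rw [(mem_gridCell hℓ).1 hy, (mem_gridCell hℓ).1 hx]
    refine (lintegral_mono_set hsub).trans (hnb.trans (le_of_eq ?_))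
    have : ℓ / 2 ^ k = 2 * (ℓ / 2 ^ (k + 1)) := by rw [pow_succ]; field_simp
    rw [this, ENNReal.ofReal_mul (by norm_num), mul_pow]
    simp only [ENNReal.ofReal_ofNat]
    ring
  · have hfin : ∫⁻ x, u x ≠ ∞ := ne_top_of_le_ne_top (by finiteness) hint
    filter_upwards [ae_tendsto_grid_average hn hu hfin hℓ] with x hx hxs
    have hgood : ∀ k, ¬ bad k (gridIdx ℓ k x) := by
      by_contra! hex
      classical
      refine hxs ?_
      refine Set.mem_biUnion ⟨(Nat.find hex, gridIdx ℓ (Nat.find hex) x),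
        ⟨Nat.find_spec hex, fun y hy j hj => ?_⟩, rfl⟩ ((mem_gridCell hℓ).2 rfl)
      rw [gridIdx_congr hj.le ((mem_gridCell hℓ).1 hy)]
      exact Nat.find_min hex hj
    refine le_of_tendsto' hx fun k => ENNReal.div_le_of_le_mul ?_
    exact not_lt.1 (hgood k)

end decomposition

/-! ### Kernel estimates and comparison of truncated integrals -/

section kernel

variable {n : ℕ} {K : Rn n → Rn n → ℂ} {A ε : ℝ}

lemma measurableSet_lt_norm_sub (x : Rn n) (δ : ℝ) : MeasurableSet {y | δ < ‖x - y‖} :=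
  measurableSet_lt measurable_const (by fun_prop)

lemma IsStandardKernel.norm_le (hK : IsStandardKernel K A ε) (hA : 0 ≤ A) {x y : Rn n} {δ : ℝ}
    (hδ : 0 < δ) (hxy : δ ≤ ‖x - y‖) : ‖K x y‖ ≤ A / δ ^ n := by
  refine (hK.size x y fun h => ?_).trans (by gcongr)
  rw [h, sub_self, norm_zero] at hxy
  linarith

/-- The regularity estimate is a local Hölder bound off the diagonal. It makes `K x` measurable for
every `x`, and not only for almost every one. -/
lemma IsStandardKernel.continuousOn (hK : IsStandardKernel K A ε) (hε : 0 < ε) (x : Rn n) :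
    ContinuousOn (K x) {x}ᶜ := by
  intro y hy
  have hxy : 0 < ‖y - x‖ := norm_pos_iff.2 (sub_ne_zero.2 hy)
  refine ContinuousAt.continuousWithinAt ?_
  rw [ContinuousAt, tendsto_iff_norm_sub_tendsto_zero]
  have hlim : Filter.Tendsto (fun z => A * ‖y - z‖ ^ ε / ‖y - x‖ ^ ((n : ℝ) + ε)) (nhds y)
      (nhds 0) := by
    have hc : ContinuousAt (fun z => A * ‖y - z‖ ^ ε / ‖y - x‖ ^ ((n : ℝ) + ε)) y := by
      refine ContinuousAt.div_const (continuousAt_const.mul ?_) _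
      exact ContinuousAt.rpow_const (by fun_prop) (Or.inr hε.le)
    have h := hc.tendsto
    simpa [Real.zero_rpow hε.ne'] using h
  have hev : ∀ᶠ z in nhds y, 2 * ‖y - z‖ < ‖y - x‖ := by
    have hc : ContinuousAt (fun z => 2 * ‖y - z‖) y := by fun_prop
    exact hc.eventually (gt_mem_nhds (by simpa using hxy))
  refine squeeze_zero' (Filter.Eventually.of_forall fun _ => norm_nonneg _) ?_ hlim
  filter_upwards [hev] with z hz
  have := hK.regularity y x z hz
  rw [norm_sub_rev]
  linarith [norm_nonneg (K y x - K z x)]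

lemma IsStandardKernel.aestronglyMeasurable (hK : IsStandardKernel K A ε) (hε : 0 < ε) {x : Rn n}
    {s : Set (Rn n)} (hs : x ∉ s) : AEStronglyMeasurable (K x) (volume.restrict s) :=
  ((hK.continuousOn hε x).aestronglyMeasurable
    (measurableSet_singleton x).compl).mono_set (by simpa using hs)

lemma IsStandardKernel.integrableOn (hK : IsStandardKernel K A ε) (hA : 0 ≤ A) (hε : 0 < ε)
    {x : Rn n} {s : Set (Rn n)} (hs : MeasurableSet s) {δ : ℝ} (hδ : 0 < δ)
    (hsδ : ∀ y ∈ s, δ ≤ ‖x - y‖) {F : Rn n → ℂ} (hF : Integrable F) :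
    IntegrableOn (fun y => K x y * F y) s := by
  refine Integrable.bdd_mul (c := A / δ ^ n) hF.integrableOn
    (hK.aestronglyMeasurable hε fun h => ?_) ?_
  · have := hsδ x h
    simp at this; linarith
  · filter_upwards [ae_restrict_mem hs] with y hy
    exact hK.norm_le hA hδ (hsδ y hy)

lemma IsStandardKernel.setLIntegral_le (hK : IsStandardKernel K A ε) (hA : 0 ≤ A)
    {x : Rn n} {s : Set (Rn n)} (hs : MeasurableSet s) {δ : ℝ} (hδ : 0 < δ)
    (hsδ : ∀ y ∈ s, δ ≤ ‖x - y‖) (F : Rn n → ℂ) :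
    ∫⁻ y in s, ‖K x y * F y‖ₑ ≤ ENNReal.ofReal (A / δ ^ n) * ∫⁻ y in s, ‖F y‖ₑ := by
  rw [← lintegral_const_mul' _ _ ENNReal.ofReal_ne_top]
  refine setLIntegral_mono' hs fun y hy => ?_
  rw [enorm_mul]
  gcongr
  rw [← ofReal_norm]
  exact ENNReal.ofReal_le_ofReal (hK.norm_le hA hδ (hsδ y hy))

/-- At distance comparable to `δ` the kernel is at most a multiple of the reciprocal volume of a
ball of radius `c * δ`, so the integral is dominated by an average. -/
lemma IsStandardKernel.setLIntegral_annulus_le (hK : IsStandardKernel K A ε) (hA : 0 ≤ A)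
    {x p : Rn n} {s : Set (Rn n)} (hs : MeasurableSet s) {δ c : ℝ} (hδ : 0 < δ) (hc : 0 < c)
    (hsδ : ∀ y ∈ s, δ ≤ ‖x - y‖ ∧ ‖x - y‖ ≤ c * δ) (hp : ‖p - x‖ ≤ c * δ) (F : Rn n → ℂ) :
    ∫⁻ y in s, ‖K x y * F y‖ₑ ≤
      ENNReal.ofReal (A * (2 * c) ^ n) * maxFn (fun y => ‖F y‖ₑ) p := by
  refine (hK.setLIntegral_le hA hs hδ (fun y hy => (hsδ y hy).1) F).trans ?_
  have hsub : s ⊆ Metric.closedBall x (c * δ) := fun y hy => by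
    rw [Metric.mem_closedBall, dist_comm, dist_eq_norm]; exact (hsδ y hy).2
  have h := (lintegral_mono_set hsub).trans
    (setLIntegral_closedBall_le (fun y => ‖F y‖ₑ) (mul_pos hc hδ) hp)
  calc _ ≤ ENNReal.ofReal (A / δ ^ n) *
        (ENNReal.ofReal (2 * (c * δ)) ^ n * maxFn (fun y => ‖F y‖ₑ) p) := by gcongr
    _ = _ := by
      rw [← mul_assoc, ← ENNReal.ofReal_pow (by positivity), ← ENNReal.ofReal_mul (by positivity)]
      congr 2
      rw [show 2 * (c * δ) = (2 * c) * δ by ring, mul_pow (2 * c)]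
      field_simp

/-- Smoothness of the kernel in the first variable, integrated. -/
lemma IsStandardKernel.setLIntegral_sub_le (hK : IsStandardKernel K A ε) (hA : 0 ≤ A) (hε : 0 < ε)
    {x x' p : Rn n} {δ : ℝ} (hδ : 0 < δ) (hx : ‖x - x'‖ ≤ δ / 3) (hp : ‖p - x‖ ≤ δ)
    (F : Rn n → ℂ) :
    ∫⁻ y in {y | δ < ‖x - y‖}, ‖(K x y - K x' y) * F y‖ₑ ≤
      ENNReal.ofReal A * decayConst n ε * maxFn (fun y => ‖F y‖ₑ) p := by
  calc _ ≤ ∫⁻ y in {y | δ < ‖x - y‖}, ENNReal.ofReal A *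
        (ENNReal.ofReal (δ ^ ε / ‖x - y‖ ^ ((n : ℝ) + ε)) * ‖F y‖ₑ) := by
        refine setLIntegral_mono' (measurableSet_lt_norm_sub x δ) fun y hy => ?_
        rw [enorm_mul, ← mul_assoc, ← ENNReal.ofReal_mul hA]
        gcongr
        rw [← ofReal_norm]
        apply ENNReal.ofReal_le_ofReal
        have hy' : δ < ‖x - y‖ := hy
        have h := hK.regularity x y x' (by linarith)
        calc ‖K x y - K x' y‖ ≤ A * ‖x - x'‖ ^ ε / ‖x - y‖ ^ ((n : ℝ) + ε) := by
              linarith [norm_nonneg (K y x - K y x')]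
          _ ≤ A * δ ^ ε / ‖x - y‖ ^ ((n : ℝ) + ε) := by
              gcongr
              linarith
          _ = _ := by ring
    _ ≤ _ := by
        rw [lintegral_const_mul' _ _ ENNReal.ofReal_ne_top, mul_assoc]
        gcongr
        exact setLIntegral_decay_le _ hε hδ hp

/-- Moving the base point of the kernel, with a fixed truncation. -/
lemma IsStandardKernel.enorm_integral_sub_le (hK : IsStandardKernel K A ε) (hA : 0 ≤ A)
    (hε : 0 < ε) {x x' p : Rn n} {δ : ℝ} (hδ : 0 < δ) (hx : ‖x - x'‖ ≤ δ / 3) (hp : ‖p - x‖ ≤ δ)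
    {F : Rn n → ℂ} (hF : Integrable F) :
    ‖(∫ y in {y | δ < ‖x - y‖}, K x y * F y) - ∫ y in {y | δ < ‖x - y‖}, K x' y * F y‖ₑ ≤
      ENNReal.ofReal A * decayConst n ε * maxFn (fun y => ‖F y‖ₑ) p := by
  rw [← integral_sub]
  · refine (enorm_integral_le_lintegral_enorm _).trans ?_
    simp only [← sub_mul]
    exact hK.setLIntegral_sub_le hA hε hδ hx hp F
  · exact hK.integrableOn hA hε (measurableSet_lt_norm_sub x δ) hδ (fun y hy => le_of_lt hy) hF
  · refine hK.integrableOn hA hε (measurableSet_lt_norm_sub x δ) (δ := 2 * δ / 3) (by positivity)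
      (fun y hy => ?_) hF
    have hy' : δ < ‖x - y‖ := hy
    have := norm_sub_le_norm_sub_add_norm_sub x x' y
    linarith

lemma enorm_setIntegral_sub_le {g : Rn n → ℂ} {s t : Set (Rn n)} (hs : MeasurableSet s)
    (ht : MeasurableSet t) (hgs : IntegrableOn g s) (hgt : IntegrableOn g t) :
    ‖(∫ y in s, g y) - ∫ y in t, g y‖ₑ ≤
      (∫⁻ y in s \ t, ‖g y‖ₑ) + ∫⁻ y in t \ s, ‖g y‖ₑ := by
  rw [← integral_inter_add_sdiff ht hgs, ← integral_inter_add_sdiff hs hgt, Set.inter_comm t s,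
    add_sub_add_left_eq_sub]
  refine (enorm_sub_le (E := ℂ)).trans ?_
  gcongr <;> exact enorm_integral_le_lintegral_enorm _

/-- The constant comparing truncated integrals at nearby points. -/
noncomputable def shiftConst (n : ℕ) (A ε : ℝ) : ℝ≥0∞ :=
  ENNReal.ofReal A * decayConst n ε + 2 * ENNReal.ofReal (A * (2 * 2) ^ n)

lemma shiftConst_ne_top (n : ℕ) (A : ℝ) {ε : ℝ} (hε : 0 < ε) : shiftConst n A ε ≠ ∞ := by
  have := decayConst_ne_top n hε
  unfold shiftConst
  finiteness

/-- Truncated integrals at nearby points differ by at most a multiple of the maximal function. -/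
theorem IsStandardKernel.enorm_truncatedIntegral_sub_le (hK : IsStandardKernel K A ε)
    (hA : 0 ≤ A) (hε : 0 < ε) {x x' : Rn n} {δ : ℝ} (hδ : 0 < δ) (hx : ‖x - x'‖ ≤ δ / 3)
    {F : Rn n → ℂ} (hF : Integrable F) :
    ‖truncatedIntegral K δ F x - truncatedIntegral K δ F x'‖ₑ ≤
      shiftConst n A ε * maxFn (fun y => ‖F y‖ₑ) x' := by
  have hms := measurableSet_lt_norm_sub (n := n) x δ
  have hms' := measurableSet_lt_norm_sub (n := n) x' δ
  have htri := fun y => norm_sub_le_norm_sub_add_norm_sub x x' y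
  have htri' := fun y => norm_sub_le_norm_sub_add_norm_sub x' x y
  have hx' : ‖x' - x‖ ≤ δ / 3 := by rwa [norm_sub_rev]
  -- The two truncation regions differ only where `2δ/3 ≤ ‖x' - y‖ ≤ 4δ/3`, an annulus of ratio two.
  -- Everything is centred at `x'`, which will be the good point in the iteration.
  have h23 : 0 < 2 * δ / 3 := by positivity
  have hfar : ∀ y ∈ {y | δ < ‖x - y‖}, 2 * δ / 3 ≤ ‖x' - y‖ := fun y hy => by
    have hy' : δ < ‖x - y‖ := hy
    linarith [htri y]
  have h1 := hK.enorm_integral_sub_le hA hε hδ hx (p := x') (by linarith) hF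
  have h2 := enorm_setIntegral_sub_le hms hms'
    (hK.integrableOn hA hε hms h23 hfar hF)
    (hK.integrableOn hA hε hms' hδ (fun y hy => le_of_lt hy) hF)
  have h3 := hK.setLIntegral_annulus_le hA (x := x') (p := x') (hms.diff hms') h23 two_pos
    (fun y hy => ⟨hfar y hy.1, by
      have : ‖x' - y‖ ≤ δ := not_lt.1 hy.2
      linarith⟩) (by simp; positivity) F
  have h4 := hK.setLIntegral_annulus_le hA (x := x') (p := x') (hms'.diff hms) h23 two_pos
    (fun y hy => by
      have h₁ : δ < ‖x' - y‖ := hy.1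
      have h₂ : ‖x - y‖ ≤ δ := not_lt.1 hy.2
      have := htri' y
      constructor <;> linarith) (by simp; positivity) F
  calc ‖truncatedIntegral K δ F x - truncatedIntegral K δ F x'‖ₑ
      = ‖((∫ y in {y | δ < ‖x - y‖}, K x y * F y) - ∫ y in {y | δ < ‖x - y‖}, K x' y * F y) +
        ((∫ y in {y | δ < ‖x - y‖}, K x' y * F y) -
          ∫ y in {y | δ < ‖x' - y‖}, K x' y * F y)‖ₑ := by
        rw [sub_add_sub_cancel]; rfl
    _ ≤ _ := (enorm_add_le _ _).trans (add_le_add h1 (h2.trans (add_le_add h3 h4)))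
    _ = _ := by rw [shiftConst]; ring

lemma le_maximalSingularIntegral (K : Rn n → Rn n → ℂ) {δ : ℝ} (hδ : 0 < δ) (F : Rn n → ℂ)
    (x : Rn n) : ‖truncatedIntegral K δ F x‖ₑ ≤ maximalSingularIntegral K F x :=
  le_iSup_of_le δ (le_iSup_of_le hδ le_rfl)

lemma IsStandardKernel.truncatedIntegral_add (hK : IsStandardKernel K A ε) (hA : 0 ≤ A)
    (hε : 0 < ε) {δ : ℝ} (hδ : 0 < δ) {F G : Rn n → ℂ} (hF : Integrable F) (hG : Integrable G)
    (x : Rn n) : truncatedIntegral K δ (F + G) x =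
      truncatedIntegral K δ F x + truncatedIntegral K δ G x := by
  unfold truncatedIntegral
  have h := fun {H : Rn n → ℂ} (hH : Integrable H) => hK.integrableOn hA hε
    (measurableSet_lt_norm_sub x δ) hδ (fun y hy => le_of_lt hy) hH
  rw [← integral_add (h hF) (h hG)]
  simp [mul_add]

lemma IsStandardKernel.maximalSingularIntegral_add_le (hK : IsStandardKernel K A ε) (hA : 0 ≤ A)
    (hε : 0 < ε) {F G : Rn n → ℂ} (hF : Integrable F) (hG : Integrable G)
    (x : Rn n) : maximalSingularIntegral K (F + G) x ≤
      maximalSingularIntegral K F x + maximalSingularIntegral K G x := by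
  refine iSup_le fun δ => iSup_le fun hδ => ?_
  rw [hK.truncatedIntegral_add hA hε hδ hF hG]
  exact (enorm_add_le _ _).trans (add_le_add (le_maximalSingularIntegral K hδ F x)
    (le_maximalSingularIntegral K hδ G x))

lemma maximalSingularIntegral_congr_ae {F G : Rn n → ℂ} (h : F =ᵐ[volume] G) (x : Rn n) :
    maximalSingularIntegral K F x = maximalSingularIntegral K G x := by
  refine iSup_congr fun δ => iSup_congr fun _ => ?_
  unfold truncatedIntegral
  congr 1
  refine setIntegral_congr_ae (measurableSet_lt_norm_sub x δ) ?_
  filter_upwards [h] with y hy _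
  rw [hy]

/-- The constant in `IsStandardKernel.maximalSingularIntegral_far_le`. -/
noncomputable def farConst (n : ℕ) (A ε : ℝ) : ℝ≥0∞ :=
  ENNReal.ofReal (A * (2 * 2) ^ n) + shiftConst n A ε

lemma farConst_ne_top (n : ℕ) (A : ℝ) {ε : ℝ} (hε : 0 < ε) : farConst n A ε ≠ ∞ := by
  have := shiftConst_ne_top n A hε
  unfold farConst
  finiteness

/-- Away from a cube, the maximal singular integral is essentially constant on the cube. -/
theorem IsStandardKernel.maximalSingularIntegral_far_le (hK : IsStandardKernel K A ε)
    (hA : 0 ≤ A) (hε : 0 < ε) (hn : 1 ≤ n) {a x x' : Rn n} {ℓ : ℝ} (hℓ : 0 < ℓ)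
    (hx : x ∈ cube a ℓ) (hx' : x' ∈ cube a ℓ) {F : Rn n → ℂ} (hF : Integrable F) :
    maximalSingularIntegral K ((Metric.closedBall a (4 * (n * ℓ)))ᶜ.indicator F) x ≤
      maximalSingularIntegral K F x' +
        farConst n A ε * maxFn (fun y => ‖F y‖ₑ) x' := by
  have hn0 : (0 : ℝ) < n := by exact_mod_cast hn
  set D := n * ℓ with hD
  have hDpos : 0 < D := by positivity
  set P := Metric.closedBall a (4 * D) with hP
  have ha : a ∈ cube a ℓ := fun i => ⟨le_rfl, by linarith⟩
  have hPm : MeasurableSet P := measurableSet_closedBall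
  have hxa := norm_sub_le_of_mem_cube hx ha
  have hxa' := norm_sub_le_of_mem_cube ha hx'
  have hxx' := norm_sub_le_of_mem_cube hx hx'
  rw [← hD] at hxa hxa' hxx'
  have hfar : ∀ y, y ∉ P → 3 * D < ‖x - y‖ := fun y hy => by
    rw [hP, Metric.mem_closedBall, dist_comm, dist_eq_norm, not_le] at hy
    have := norm_sub_le_norm_sub_add_norm_sub a x y
    rw [norm_sub_rev a x] at this
    linarith
  refine iSup_le fun δ => iSup_le fun hδ => ?_
  -- Outside `P` nothing lies within `3D` of `x`, so the truncation may be raised to `δ'` for free;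
  -- then `‖x - x'‖ ≤ D ≤ δ' / 3` allows the shift to `x'`.
  set δ' := max δ (3 * D) with hδ'
  have hδ'pos : 0 < δ' := lt_max_of_lt_left hδ
  have hms := measurableSet_lt_norm_sub (n := n) x δ'
  have h1 : truncatedIntegral K δ (Pᶜ.indicator F) x =
      ∫ y in {y | δ' < ‖x - y‖} ∩ Pᶜ, K x y * F y := by
    have hind : ∀ y, K x y * Pᶜ.indicator F y = Pᶜ.indicator (fun y => K x y * F y) y := fun y => by
      by_cases hy : y ∈ Pᶜ <;> simp [hy]
    simp only [truncatedIntegral, hind]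
    rw [setIntegral_indicator hPm.compl]
    congr 2
    ext y
    simp only [Set.mem_inter_iff, Set.mem_ofPred_eq, Set.mem_compl_iff, hδ', max_lt_iff]
    exact ⟨fun h => ⟨⟨h.1, hfar y h.2⟩, h.2⟩, fun h => ⟨h.1.1, h.2⟩⟩
  -- Putting `P` back adds only points at distance between `3D` and `5D` from `x`.
  have h2 : ‖(∫ y in {y | δ' < ‖x - y‖} ∩ Pᶜ, K x y * F y) - truncatedIntegral K δ' F x‖ₑ ≤
      ENNReal.ofReal (A * (2 * 2) ^ n) * maxFn (fun y => ‖F y‖ₑ) x' := by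
    have hi := hK.integrableOn hA hε hms hδ'pos (fun y hy => le_of_lt hy) hF
    have h := enorm_setIntegral_sub_le (hms.inter hPm.compl) hms
      (hi.mono_set Set.inter_subset_left) hi
    refine h.trans ?_
    rw [Set.sdiff_eq_empty.2 Set.inter_subset_left, setLIntegral_empty, zero_add]
    refine hK.setLIntegral_annulus_le hA (hms.diff (hms.inter hPm.compl))
      (δ := 3 * D) (by positivity) two_pos (fun y hy => ?_) ?_ F
    · have hy1 : δ' < ‖x - y‖ := hy.1
      have hyP : y ∈ P := by
        by_contra hyP
        exact hy.2 ⟨hy.1, hyP⟩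
      rw [hP, Metric.mem_closedBall, dist_comm, dist_eq_norm] at hyP
      have := norm_sub_le_norm_sub_add_norm_sub x a y
      exact ⟨(le_max_right _ _).trans hy1.le, by linarith⟩
    · rw [norm_sub_rev]; linarith
  have h3 := hK.enorm_truncatedIntegral_sub_le hA hε hδ'pos (x := x) (x' := x')
    (by linarith [le_max_right δ (3 * D)]) hF
  have h4 := le_maximalSingularIntegral K hδ'pos F x'
  rw [h1]
  calc ‖∫ y in {y | δ' < ‖x - y‖} ∩ Pᶜ, K x y * F y‖ₑ
      = ‖truncatedIntegral K δ' F x' +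
        (((∫ y in {y | δ' < ‖x - y‖} ∩ Pᶜ, K x y * F y) - truncatedIntegral K δ' F x) +
        (truncatedIntegral K δ' F x - truncatedIntegral K δ' F x'))‖ₑ := by
        congr 1; ring
    _ ≤ _ := (enorm_add_le _ _).trans (add_le_add h4 ((enorm_add_le _ _).trans (add_le_add h2 h3)))
    _ = _ := by rw [farConst]; ring

end kernel

/-! ### The kernel formula for functions in `L¹ ∩ L²` -/

section representation

variable {n : ℕ}

/-- The operator `S` on `L²` is given off the support by integration against `K`. -/
def RepresentedBy (S : Lp ℂ 2 (volume : Measure (Rn n)) →L[ℂ] Lp ℂ 2 (volume : Measure (Rn n)))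
    (K : Rn n → Rn n → ℂ) : Prop :=
  ∀ (h : Rn n → ℂ) (h2 : MemLp h 2 volume), Integrable h → ∀ (x₀ : Rn n) (δ : ℝ), 0 < δ →
    (∀ y ∈ Metric.ball x₀ δ, h y = 0) →
    ∀ᵐ z, z ∈ Metric.ball x₀ (δ / 2) → S (h2.toLp h) z = ∫ y, K z y * h y

/-- Convergence in `L²` gives convergence almost everywhere along a subsequence on the operator
side; the kernel side converges at each point of `V`, so the limits agree. -/
lemma ae_eq_integral_of_tendsto
    (S : Lp ℂ 2 (volume : Measure (Rn n)) →L[ℂ] Lp ℂ 2 (volume : Measure (Rn n)))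
    (K : Rn n → Rn n → ℂ) {u : ℕ → Rn n → ℂ} {h : Rn n → ℂ} (hu : ∀ k, MemLp (u k) 2 volume)
    (hh : MemLp h 2 volume)
    (hlim : Filter.Tendsto (fun k => eLpNorm (u k - h) 2 volume) Filter.atTop (nhds 0))
    {V : Set (Rn n)} (hrep : ∀ k, ∀ᵐ z, z ∈ V → S ((hu k).toLp (u k)) z = ∫ y, K z y * u k y)
    (hK : ∀ z ∈ V, Filter.Tendsto (fun k => ∫ y, K z y * u k y) Filter.atTop
      (nhds (∫ y, K z y * h y))) :
    ∀ᵐ z, z ∈ V → S (hh.toLp h) z = ∫ y, K z y * h y := by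
  have h1 : Filter.Tendsto (fun k => S ((hu k).toLp (u k))) Filter.atTop
      (nhds (S (hh.toLp h))) :=
    (S.continuous.tendsto _).comp ((Lp.tendsto_Lp_iff_tendsto_eLpNorm'' u hu h hh).2 hlim)
  obtain ⟨ns, hns, hae⟩ := (tendstoInMeasure_of_tendsto_Lp h1).exists_seq_tendsto_ae
  filter_upwards [hae, ae_all_iff.2 hrep] with z hz hz' hzV
  refine tendsto_nhds_unique hz (((hK z hzV).comp hns.tendsto_atTop).congr fun k => ?_)
  exact (hz' (ns k) hzV).symm

lemma tendsto_eLpNorm_indicator_ball_sub {h : Rn n → ℂ} (hh : MemLp h 2 volume) (x₀ : Rn n) :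
    Filter.Tendsto (fun k : ℕ => eLpNorm ((Metric.ball x₀ k).indicator h - h) 2 volume)
      Filter.atTop (nhds 0) := by
  have hfin : ∫⁻ x : Rn n, ‖h x‖ₑ ^ (2 : ℝ) ≠ ∞ := by
    have := lintegral_rpow_enorm_lt_top_of_eLpNorm_lt_top (p := 2) (by simp) (by simp) hh.2
    simpa using this.ne
  have hlim : Filter.Tendsto
      (fun k : ℕ => ∫⁻ x : Rn n, ‖((Metric.ball x₀ k).indicator h - h) x‖ₑ ^ (2 : ℝ))
      Filter.atTop (nhds (∫⁻ _ : Rn n, 0)) := by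
    refine tendsto_lintegral_of_dominated_convergence' (fun x => ‖h x‖ₑ ^ (2 : ℝ)) (fun k => ?_)
      (fun k => Filter.Eventually.of_forall fun x => ?_) hfin
      (Filter.Eventually.of_forall fun x => ?_)
    · exact (((hh.1.indicator measurableSet_ball).sub hh.1).enorm).pow_const _
    · simp only
      gcongr
      by_cases hx : x ∈ Metric.ball x₀ k <;> simp [hx]
    · obtain ⟨N, hN⟩ := exists_nat_gt (dist x x₀)
      refine tendsto_const_nhds.congr' ?_
      filter_upwards [Filter.eventually_ge_atTop N] with k hk
      have hx : x ∈ Metric.ball x₀ k := by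
        rw [Metric.mem_ball]
        exact hN.trans_le (by exact_mod_cast hk)
      simp [hx]
  rw [lintegral_zero] at hlim
  have h2 := ((ENNReal.continuous_rpow_const (y := 1 / 2)).tendsto 0).comp hlim
  rw [ENNReal.zero_rpow_of_pos (by norm_num)] at h2
  refine h2.congr fun k => ?_
  rw [eLpNorm_eq_lintegral_rpow_enorm_toReal (by simp) (by simp)]
  simp

variable {K : Rn n → Rn n → ℂ} {A ε B : ℝ}

/-- Multiplying smooth approximants by `ψ` forces them to vanish near `x₀`, so that the kernel
formula for test functions applies there. -/
lemma exists_cutoff (x₀ : Rn n) {δ R : ℝ} (hδ : 0 < δ) (hR : 0 < R) :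
    ∃ ψ : Rn n → ℝ, ContDiff ℝ (⊤ : ℕ∞) ψ ∧ HasCompactSupport ψ ∧ (∀ y, ψ y ∈ Set.Icc (0 : ℝ) 1) ∧
      (∀ y ∈ Metric.ball x₀ (3 * δ / 4), ψ y = 0) ∧
      (∀ y ∉ Metric.ball x₀ δ, y ∈ Metric.ball x₀ R → ψ y = 1) ∧
      (∀ y ∉ Metric.ball x₀ (2 * R), ψ y = 0) := by
  let b₁ : ContDiffBump x₀ := ⟨3 * δ / 4, δ, by positivity, by linarith⟩
  let b₂ : ContDiffBump x₀ := ⟨R, 2 * R, hR, by linarith⟩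
  refine ⟨fun y => b₂ y * (1 - b₁ y), ?_, ?_, fun y => ⟨?_, ?_⟩, fun y hy => ?_, fun y hy hy' => ?_,
    fun y hy => ?_⟩
  · exact b₂.contDiff.mul (contDiff_const.sub b₁.contDiff)
  · exact b₂.hasCompactSupport.mul_right
  · exact mul_nonneg b₂.nonneg (sub_nonneg.2 b₁.le_one)
  · exact mul_le_one₀ b₂.le_one (sub_nonneg.2 b₁.le_one) (by linarith [b₁.nonneg (x := y)])
  · dsimp only; rw [b₁.one_of_mem_closedBall (Metric.ball_subset_closedBall hy)]; simp
  · dsimp only; rw [b₁.zero_of_le_dist (by simpa using hy),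
      b₂.one_of_mem_closedBall (Metric.ball_subset_closedBall hy')]; simp
  · dsimp only; rw [b₂.zero_of_le_dist (by simpa using hy)]; simp

/-- Convergence in `L²` with supports in a fixed ball gives convergence of the kernel integrals. -/
lemma IsStandardKernel.tendsto_integral (hK : IsStandardKernel K A ε) (hA : 0 ≤ A) (hε : 0 < ε)
    {z x₀ : Rn n} {δ R : ℝ} (hδ : 0 < δ)
    {u : ℕ → Rn n → ℂ} {h : Rn n → ℂ} (hu : ∀ k, MemLp (u k) 2 volume) (hh : MemLp h 2 volume)
    (hui : ∀ k, Integrable (u k)) (hhi : Integrable h)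
    (hu0 : ∀ k y, ‖z - y‖ < δ ∨ y ∉ Metric.ball x₀ R → u k y = h y)
    (hh0 : ∀ y, ‖z - y‖ < δ → h y = 0)
    (hlim : Filter.Tendsto (fun k => eLpNorm (u k - h) 2 volume) Filter.atTop (nhds 0)) :
    Filter.Tendsto (fun k => ∫ y, K z y * u k y) Filter.atTop (nhds (∫ y, K z y * h y)) := by
  set s : Set (Rn n) := {y | δ ≤ ‖z - y‖} with hs
  have hsm : MeasurableSet s := measurableSet_le measurable_const (by fun_prop)
  have hrest : ∀ v : Rn n → ℂ, (∀ y, ‖z - y‖ < δ → v y = 0) →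
      ∫ y, K z y * v y = ∫ y in s, K z y * v y := fun v hv => by
    refine (setIntegral_eq_integral_of_forall_compl_eq_zero fun y hy => ?_).symm
    rw [hv y (not_le.1 hy), mul_zero]
  rw [hrest h hh0]
  have hu00 : ∀ k y, ‖z - y‖ < δ → u k y = 0 := fun k y hy =>
    (hu0 k y (Or.inl hy)).trans (hh0 y hy)
  simp_rw [fun k => hrest (u k) (hu00 k)]
  rw [tendsto_iff_edist_tendsto_0]
  set V := Metric.ball x₀ R with hV
  -- The Hölder factor that turns the `L²` error into an `L¹` error. It is finite because `u k - h`
  -- vanishes outside the ball `V`.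
  set c : ℝ≥0∞ := volume V ^ ((1 : ℝ) / (1 : ℝ≥0∞).toReal - 1 / (2 : ℝ≥0∞).toReal) with hc
  have hctop : c ≠ ∞ := by
    refine ENNReal.rpow_ne_top_of_nonneg (by norm_num) measure_ball_lt_top.ne
  have hbound : ∀ k, edist (∫ y in s, K z y * u k y) (∫ y in s, K z y * h y) ≤
      ENNReal.ofReal (A / δ ^ n) * (eLpNorm (u k - h) 2 volume * c) := by
    intro k
    rw [edist_eq_enorm_sub, ← integral_sub (hK.integrableOn hA hε hsm hδ (fun y hy => hy) (hui k))
      (hK.integrableOn hA hε hsm hδ (fun y hy => hy) hhi)]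
    simp only [← mul_sub]
    refine (enorm_integral_le_lintegral_enorm _).trans ?_
    refine (hK.setLIntegral_le hA hsm hδ (fun y hy => hy) (u k - h)).trans ?_
    gcongr
    calc ∫⁻ y in s, ‖(u k - h) y‖ₑ ≤ ∫⁻ y, ‖(u k - h) y‖ₑ := setLIntegral_le_lintegral _ _
      _ = ∫⁻ y in V, ‖(u k - h) y‖ₑ := by
          refine (setLIntegral_eq_of_support_subset ?_).symm
          intro y hy
          by_contra hyV
          refine hy ?_
          simp [hu0 k y (Or.inr hyV)]
      _ = eLpNorm (u k - h) 1 (volume.restrict V) := eLpNorm_one_eq_lintegral_enorm.symm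
      _ ≤ eLpNorm (u k - h) 2 (volume.restrict V) * c := by
          have := eLpNorm_le_eLpNorm_mul_rpow_measure_univ (p := 1) (q := 2)
            (μ := volume.restrict V) (f := u k - h) one_le_two
            ((hu k).1.sub hh.1).restrict
          simpa [hc] using this
      _ ≤ _ := by gcongr; exact Measure.restrict_le_self
  have hz' : Filter.Tendsto (fun k => ENNReal.ofReal (A / δ ^ n) *
      (eLpNorm (u k - h) 2 volume * c)) Filter.atTop (nhds 0) := by
    have h1 := ENNReal.Tendsto.mul_const hlim (Or.inr hctop)
    rw [zero_mul] at h1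
    have h2 := ENNReal.Tendsto.const_mul (a := ENNReal.ofReal (A / δ ^ n)) h1
      (Or.inr ENNReal.ofReal_ne_top)
    rwa [mul_zero] at h2
  exact tendsto_of_tendsto_of_tendsto_of_le_of_le tendsto_const_nhds hz' (fun _ => zero_le)
    hbound

/-- Density in two stages: boundedly supported functions are approximated by test functions cut off
near `x₀`, and general ones by restriction to large balls. -/
theorem IsCalderonZygmund.exists_representedBy {T : SmoothCc n →ₗ[ℂ] (Rn n →ₘ[volume] ℂ)}
    (hT : IsCalderonZygmund T K A ε B) (hA : 0 ≤ A) (hε : 0 < ε) :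
    ∃ S : Lp ℂ 2 (volume : Measure (Rn n)) →L[ℂ] Lp ℂ 2 (volume : Measure (Rn n)),
      ‖S‖ ≤ B ∧ RepresentedBy S K := by
  obtain ⟨S, hSB, hST⟩ := hT.extends_L2
  have hK := hT.kernel
  refine ⟨S, hSB, ?_⟩
  have hbdd : ∀ (h : Rn n → ℂ) (h2 : MemLp h 2 volume), Integrable h → ∀ (x₀ : Rn n) (δ R : ℝ),
      0 < δ → δ < R → (∀ y ∈ Metric.ball x₀ δ, h y = 0) → (∀ y ∉ Metric.ball x₀ R, h y = 0) →
      ∀ᵐ z, z ∈ Metric.ball x₀ (δ / 2) → S (h2.toLp h) z = ∫ y, K z y * h y := by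
    intro h h2 hi x₀ δ R hδ hδR h0 h0'
    have hR : 0 < R := hδ.trans hδR
    obtain ⟨ψ, hψc, hψs, hψ01, hψ0, hψ1, hψ2⟩ := exists_cutoff x₀ hδ hR
    have hex : ∀ k : ℕ, ∃ g : Rn n → ℂ, HasCompactSupport g ∧ ContDiff ℝ (⊤ : ℕ∞) g ∧
        eLpNorm (h - g) 2 volume ≤ ENNReal.ofReal (1 / (k + 1 : ℝ)) := fun k =>
      MemLp.exist_eLpNorm_sub_le (by simp) (by simp) h2 (by positivity)
    choose g hgs hgc hgl using hex
    set u : ℕ → Rn n → ℂ := fun k y => (ψ y : ℂ) * g k y with hu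
    have hψc' : ContDiff ℝ (⊤ : ℕ∞) (fun y => (ψ y : ℂ)) :=
      Complex.ofRealCLM.contDiff.comp hψc
    have huc : ∀ k, ContDiff ℝ (⊤ : ℕ∞) (u k) := fun k => hψc'.mul (hgc k)
    have hus : ∀ k, HasCompactSupport (u k) := fun k => (hgs k).mul_left
    let φ : ℕ → SmoothCc n := fun k => ⟨u k, huc k, hus k, fun _ _ => trivial⟩
    have hu2 : ∀ k, MemLp (u k) 2 volume := fun k =>
      (huc k).continuous.memLp_of_hasCompactSupport (hus k)
    have hui : ∀ k, Integrable (u k) := fun k =>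
      (huc k).continuous.integrable_of_hasCompactSupport (hus k)
    -- Since `ψ h = h` and `0 ≤ ψ ≤ 1`, the cutoff does not increase the `L²` error of the
    -- approximation.
    have hψh : ∀ y, (ψ y : ℂ) * h y = h y := fun y => by
      by_cases hy : y ∈ Metric.ball x₀ δ
      · rw [h0 y hy, mul_zero]
      · by_cases hy' : y ∈ Metric.ball x₀ R
        · rw [hψ1 y hy hy']; simp
        · rw [h0' y hy', mul_zero]
    have hlim : Filter.Tendsto (fun k => eLpNorm (u k - h) 2 volume) Filter.atTop (nhds 0) := by
      have hz : Filter.Tendsto (fun k : ℕ => ENNReal.ofReal (1 / (k + 1 : ℝ))) Filter.atTop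
          (nhds 0) := by
        have := ENNReal.tendsto_ofReal (tendsto_one_div_add_atTop_nhds_zero_nat (𝕜 := ℝ))
        simpa using this
      refine tendsto_of_tendsto_of_tendsto_of_le_of_le tendsto_const_nhds hz
        (fun _ => zero_le) fun k => ?_
      refine le_trans ?_ (hgl k)
      rw [eLpNorm_sub_comm]
      refine eLpNorm_mono fun y => ?_
      have : (h - u k) y = (ψ y : ℂ) * (h - g k) y := by
        simp only [Pi.sub_apply, hu]; rw [mul_sub, hψh]
      rw [this, norm_mul, Complex.norm_real, Real.norm_of_nonneg (hψ01 y).1]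
      exact mul_le_of_le_one_left (norm_nonneg _) (hψ01 y).2
    have hnear : ∀ z ∈ Metric.ball x₀ (δ / 2), ∀ y, ‖z - y‖ < δ / 4 →
        y ∈ Metric.ball x₀ (3 * δ / 4) := fun z hz y hy => by
      rw [Metric.mem_ball, dist_eq_norm] at hz ⊢
      have := norm_sub_le_norm_sub_add_norm_sub y z x₀
      rw [norm_sub_rev y z] at this
      linarith
    refine ae_eq_integral_of_tendsto S K hu2 h2 hlim (fun k => ?_) fun z hz => ?_
    · have h1 := hST (φ k) ((hu2 k).toLp (u k)) (hu2 k).coeFn_toLp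
      filter_upwards [h1, hT.representation (φ k)] with z hz1 hz2 hz
      rw [hz1, hz2 ?_]
      · rfl
      · change z ∉ tsupport (u k)
        rw [notMem_tsupport_iff_eventuallyEq]
        filter_upwards [Metric.isOpen_ball.mem_nhds hz] with y hy
        simp [hu, hψ0 y (Metric.ball_subset_ball (by linarith) hy)]
    · refine hK.tendsto_integral hA hε (δ := δ / 4) (x₀ := x₀) (R := 2 * R) (by positivity)
        hu2 h2 hui hi ?_ ?_ hlim
      · rintro k y (hy | hy)
        · have hy' := hnear z hz y hy
          rw [h0 y (Metric.ball_subset_ball (by linarith) hy')]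
          simp [hu, hψ0 y hy']
        · rw [h0' y fun h => hy (Metric.ball_subset_ball (by linarith) h)]
          simp [hu, hψ2 y hy]
      · exact fun y hy => h0 y (Metric.ball_subset_ball (by linarith) (hnear z hz y hy))
  intro h h2 hi x₀ δ hδ h0
  have hnear : ∀ z ∈ Metric.ball x₀ (δ / 2), ∀ y, y ∉ Metric.ball x₀ δ → δ / 2 ≤ ‖z - y‖ :=
    fun z hz y hy => by
      rw [Metric.mem_ball, dist_eq_norm] at hz
      rw [Metric.mem_ball, dist_eq_norm, not_lt] at hy
      have := norm_sub_le_norm_sub_add_norm_sub y z x₀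
      rw [norm_sub_rev y z] at this
      linarith
  -- The shift by `N` keeps every radius above `δ`, as `hbdd` requires.
  obtain ⟨N, hN⟩ := exists_nat_gt δ
  have hshift : Filter.Tendsto (fun k : ℕ => k + N) Filter.atTop Filter.atTop :=
    Filter.tendsto_add_atTop_nat N
  refine ae_eq_integral_of_tendsto S K
    (u := fun k => (Metric.ball x₀ ((k + N : ℕ) : ℝ)).indicator h)
    (fun k => h2.indicator measurableSet_ball) h2
    ((tendsto_eLpNorm_indicator_ball_sub h2 x₀).comp hshift) (fun k => ?_) fun z hz => ?_
  · refine hbdd _ _ (hi.indicator measurableSet_ball) x₀ δ (k + N : ℕ) hδ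
      (hN.trans_le (by push_cast; linarith [Nat.cast_nonneg (α := ℝ) k])) (fun y hy => ?_)
      fun y hy => Set.indicator_of_notMem hy h
    exact Set.indicator_apply_eq_zero.2 fun _ => h0 y hy
  · have hrest : ∀ v : Rn n → ℂ, (∀ y ∈ Metric.ball x₀ δ, v y = 0) →
        ∫ y, K z y * v y = ∫ y in (Metric.ball x₀ δ)ᶜ, K z y * v y := fun v hv => by
      refine (setIntegral_eq_integral_of_forall_compl_eq_zero fun y hy => ?_).symm
      rw [hv y (by simpa using hy), mul_zero]
    have hint := hK.integrableOn hA hε measurableSet_ball.compl (half_pos hδ) (hnear z hz) hi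
    rw [hrest h h0]
    have h0k : ∀ k : ℕ, ∀ y ∈ Metric.ball x₀ δ,
        (Metric.ball x₀ ((k + N : ℕ) : ℝ)).indicator h y = 0 := fun k y hy => by
      exact Set.indicator_apply_eq_zero.2 fun _ => h0 y hy
    simp_rw [fun k => hrest _ (h0k k)]
    refine tendsto_integral_of_dominated_convergence (fun y => ‖K z y * h y‖) (fun k => ?_)
      hint.norm (fun k => ?_) ?_
    · exact (hK.integrableOn hA hε measurableSet_ball.compl (half_pos hδ) (hnear z hz)
        (hi.indicator measurableSet_ball)).1
    · refine Filter.Eventually.of_forall fun y => ?_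
      rw [norm_mul, norm_mul]
      gcongr
      exact norm_indicator_le_norm_self h y
    · refine Filter.Eventually.of_forall fun y => ?_
      obtain ⟨M, hM⟩ := exists_nat_gt (dist y x₀)
      refine tendsto_const_nhds.congr' ?_
      filter_upwards [Filter.eventually_ge_atTop M] with k hk
      have hy : y ∈ Metric.ball x₀ ((k + N : ℕ) : ℝ) := by
        rw [Metric.mem_ball]
        exact hM.trans_le (by exact_mod_cast (by omega : M ≤ k + N))
      rw [Set.indicator_of_mem hy]

end representation

/-! ### Cotlar's inequality and the weak type (2,2) -/

section cotlar

variable {n : ℕ} {K : Rn n → Rn n → ℂ} {A ε B : ℝ}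

/-- Cauchy–Schwarz on each cube. -/
lemma maxFn_sq_le {u : Rn n → ℝ≥0∞} (hu : AEMeasurable u volume) (x : Rn n) :
    maxFn u x ^ 2 ≤ maxFn (fun y => u y ^ 2) x := by
  set N := maxFn (fun y => u y ^ 2) x with hN
  have key : maxFn u x ≤ N ^ (1 / 2 : ℝ) := by
    refine maxFn_le_of_forall fun a ℓ hℓ hx => ?_
    have h := ENNReal.lintegral_mul_le_Lp_mul_Lq (volume.restrict (cube a ℓ))
      (Real.HolderConjugate.two_two) hu.restrict (aemeasurable_const (b := (1 : ℝ≥0∞)))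
    simp only [Pi.mul_apply, mul_one, ENNReal.one_rpow, lintegral_const, one_mul,
      Measure.restrict_apply_univ, volume_cube] at h
    refine h.trans ?_
    have h2 : ∫⁻ y in cube a ℓ, u y ^ (2 : ℝ) ≤ ENNReal.ofReal ℓ ^ n * N := by
      simpa only [ENNReal.rpow_two] using setLIntegral_cube_le (fun y => u y ^ 2) hℓ hx
    calc _ ≤ (ENNReal.ofReal ℓ ^ n * N) ^ (1 / 2 : ℝ) * (ENNReal.ofReal ℓ ^ n) ^ (1 / 2 : ℝ) := by
          gcongr
      _ = N ^ (1 / 2 : ℝ) * ((ENNReal.ofReal ℓ ^ n) ^ (1 / 2 : ℝ) *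
          (ENNReal.ofReal ℓ ^ n) ^ (1 / 2 : ℝ)) := by
          rw [ENNReal.mul_rpow_of_nonneg _ _ (by norm_num)]; ring
      _ = _ := by
          rw [← ENNReal.rpow_add_of_nonneg _ _ (by norm_num) (by norm_num)]
          norm_num
  calc maxFn u x ^ 2 ≤ (N ^ (1 / 2 : ℝ)) ^ 2 := by gcongr
    _ = N := by
      rw [← ENNReal.rpow_natCast, ← ENNReal.rpow_mul]; norm_num

lemma lintegral_enorm_sq_eq (f : Lp ℂ 2 (volume : Measure (Rn n))) :
    ∫⁻ x, ‖f x‖ₑ ^ 2 = ‖f‖ₑ ^ 2 := by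
  rw [Lp.enorm_def, eLpNorm_eq_lintegral_rpow_enorm_toReal (by simp) (by simp),
    ← ENNReal.rpow_natCast, ← ENNReal.rpow_mul]
  simp

lemma lintegral_enorm_apply_sq_le
    {S : Lp ℂ 2 (volume : Measure (Rn n)) →L[ℂ] Lp ℂ 2 (volume : Measure (Rn n))} (hS : ‖S‖ ≤ B)
    {h : Rn n → ℂ} (hh : MemLp h 2 volume) :
    ∫⁻ x, ‖S (hh.toLp h) x‖ₑ ^ 2 ≤ ENNReal.ofReal B ^ 2 * ∫⁻ x, ‖h x‖ₑ ^ 2 := by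
  have h1 : ∫⁻ x, ‖h x‖ₑ ^ 2 = ∫⁻ x, ‖hh.toLp h x‖ₑ ^ 2 := by
    refine lintegral_congr_ae ?_
    filter_upwards [hh.coeFn_toLp] with x hx
    rw [hx]
  rw [h1, lintegral_enorm_sq_eq, lintegral_enorm_sq_eq, ← mul_pow]
  gcongr
  rw [← ofReal_norm, ← ofReal_norm, ← ENNReal.ofReal_mul ((norm_nonneg S).trans hS)]
  exact ENNReal.ofReal_le_ofReal (S.le_of_opNorm_le hS _)

lemma ENNReal.add_add_sq_le (a b c : ℝ≥0∞) : (a + b + c) ^ 2 ≤ 3 * (a ^ 2 + b ^ 2 + c ^ 2) := by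
  by_cases h : a = ∞ ∨ b = ∞ ∨ c = ∞
  · have : a ^ 2 + b ^ 2 + c ^ 2 = ∞ := by
      rcases h with rfl | rfl | rfl <;> simp
    rw [this, ENNReal.mul_top (by norm_num)]
    exact le_top
  · push Not at h
    lift a to NNReal using h.1
    lift b to NNReal using h.2.1
    lift c to NNReal using h.2.2
    norm_cast
    rw [← NNReal.coe_le_coe]
    push_cast
    nlinarith [sq_nonneg ((a : ℝ) - b), sq_nonneg ((a : ℝ) - c), sq_nonneg ((b : ℝ) - c)]

/-- The constant in Cotlar's inequality `maximalSingularIntegral_sq_le`. -/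
noncomputable def cotlarConst (n : ℕ) (A ε B : ℝ) : ℝ≥0∞ :=
  3 * ((ENNReal.ofReal A * decayConst n ε) ^ 2 + 1 + ENNReal.ofReal B ^ 2 * (4 * n) ^ n)

lemma cotlarConst_ne_top (n : ℕ) (A B : ℝ) {ε : ℝ} (hε : 0 < ε) : cotlarConst n A ε B ≠ ∞ := by
  have := decayConst_ne_top n hε
  unfold cotlarConst
  finiteness

lemma cotlarConst_ne_zero (n : ℕ) (A B ε : ℝ) : cotlarConst n A ε B ≠ 0 := by
  simp [cotlarConst]

/-- **Cotlar's inequality** for the maximal singular integral, in quadratic form. -/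
theorem maximalSingularIntegral_sq_le (hn : 1 ≤ n) (hK : IsStandardKernel K A ε) (hA : 0 ≤ A)
    (hε : 0 < ε) {S : Lp ℂ 2 (volume : Measure (Rn n)) →L[ℂ] Lp ℂ 2 (volume : Measure (Rn n))}
    (hS : ‖S‖ ≤ B) (hrep : RepresentedBy S K) {F : Rn n → ℂ} (hF : Integrable F)
    (hF2 : MemLp F 2 volume) (x : Rn n) :
    maximalSingularIntegral K F x ^ 2 ≤ cotlarConst n A ε B *
      (maxFn (fun y => ‖F y‖ₑ ^ 2) x + maxFn (fun y => ‖S (hF2.toLp F) y‖ₑ ^ 2) x) := by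
  have hn0 : (0 : ℝ) < n := by exact_mod_cast hn
  set MF := maxFn (fun y => ‖F y‖ₑ ^ 2) x with hMF
  set MG := maxFn (fun y => ‖S (hF2.toLp F) y‖ₑ ^ 2) x with hMG
  have key : ∀ δ : ℝ, 0 < δ →
      ‖truncatedIntegral K δ F x‖ₑ ^ 2 ≤ cotlarConst n A ε B * (MF + MG) := by
    intro δ hδ
    -- Keeps `Q` within `δ / 4` of `x`, inside both the range `δ / 3` for moving the base point and
    -- the ball of radius `δ / 2` where the kernel formula holds.
    set r := δ / (4 * n) with hr
    have hrpos : 0 < r := by positivity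
    set Q := centredCube x r with hQ
    have hQx : ∀ z ∈ Q, ‖x - z‖ ≤ δ / 4 := fun z hz => by
      rw [norm_sub_rev]
      refine (norm_le_of_coord (s := r) fun i => mem_centredCube.1 hz i).trans (le_of_eq ?_)
      rw [hr]; field_simp
    have hxQ : x ∈ Q := mem_centredCube.2 fun i => by simp [hrpos.le]
    have hQm : MeasurableSet Q := measurableSet_cube _ _
    have hQvol : volume Q = ENNReal.ofReal (2 * r) ^ n := volume_centredCube _ _
    set P := Metric.closedBall x δ with hP
    have hPm : MeasurableSet P := measurableSet_closedBall
    have hF1 : MemLp (P.indicator F) 2 volume := hF2.indicator hPm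
    have hF3 : MemLp (Pᶜ.indicator F) 2 volume := hF2.indicator hPm.compl
    have hsum : S (hF2.toLp F) = S (hF1.toLp _) + S (hF3.toLp _) := by
      rw [← map_add, ← MemLp.toLp_add]
      congr 1
      refine (MemLp.toLp_eq_toLp_iff _ _).2 (Filter.EventuallyEq.of_eq ?_)
      exact (Set.indicator_self_add_compl P F).symm
    have hset : {y | δ < ‖x - y‖} = Pᶜ := by
      ext y
      simp [hP, dist_eq_norm, norm_sub_rev x y]
    set a := ENNReal.ofReal A * decayConst n ε * maxFn (fun y => ‖F y‖ₑ) x with ha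
    -- For almost every `z ∈ Q` the integral of `K z` against the far part of `F` is `S F (z) - S
    -- (1_P F) (z)`; replacing `K x` by `K z` costs `a`. The squared bound is then averaged over
    -- `Q`.
    have hpt : ∀ᵐ z, z ∈ Q → ‖truncatedIntegral K δ F x‖ₑ ^ 2 ≤
        3 * (a ^ 2 + ‖S (hF2.toLp F) z‖ₑ ^ 2 + ‖S (hF1.toLp _) z‖ₑ ^ 2) := by
      have h3 := hrep _ hF3 (hF.indicator hPm.compl) x δ hδ fun y hy =>
        Set.indicator_of_notMem (Set.notMem_compl_iff.2 (Metric.ball_subset_closedBall hy)) F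
      have hadd := Lp.coeFn_add (S (hF1.toLp _)) (S (hF3.toLp _))
      rw [← hsum] at hadd
      filter_upwards [h3, hadd] with z hz3 hzadd hzQ
      have hzx := hQx z hzQ
      have h3' := hz3 (by rw [Metric.mem_ball, dist_comm, dist_eq_norm]; linarith)
      have hind : ∀ y, K z y * Pᶜ.indicator F y = Pᶜ.indicator (fun y => K z y * F y) y :=
        fun y => by by_cases hy : y ∈ Pᶜ <;> simp [hy]
      simp only [hind] at h3'
      rw [integral_indicator hPm.compl] at h3'
      rw [Pi.add_apply, h3'.trans (by rw [hset] : _ = ∫ y in {y | δ < ‖x - y‖}, K z y * F y)]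
        at hzadd
      have h1 := hK.enorm_integral_sub_le hA hε hδ (x := x) (x' := z) (p := x) (by linarith)
        (by simp [hδ.le]) hF
      refine le_trans ?_ (ENNReal.add_add_sq_le _ _ _)
      gcongr
      calc ‖truncatedIntegral K δ F x‖ₑ
          = ‖((∫ y in {y | δ < ‖x - y‖}, K x y * F y) - ∫ y in {y | δ < ‖x - y‖}, K z y * F y)
            + S (hF2.toLp F) z - S (hF1.toLp _) z‖ₑ := by
            rw [hzadd, truncatedIntegral]; congr 1; ring
        _ ≤ _ := (enorm_sub_le (E := ℂ)).trans (by
            gcongr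
            exact (enorm_add_le _ _).trans (by gcongr))
    have hQ0 : volume Q ≠ 0 := by
      rw [hQvol]; exact pow_ne_zero _ (by simpa using hrpos)
    have hQtop : volume Q ≠ ∞ := by rw [hQvol]; finiteness
    have hint : volume Q * ‖truncatedIntegral K δ F x‖ₑ ^ 2 ≤
        volume Q * (cotlarConst n A ε B * (MF + MG)) := by
      have hmG : AEMeasurable (fun z => ‖S (hF2.toLp F) z‖ₑ ^ 2) (volume.restrict Q) :=
        ((Lp.aestronglyMeasurable _).enorm.pow_const 2).restrict
      have hG : ∫⁻ z in Q, ‖S (hF2.toLp F) z‖ₑ ^ 2 ≤ volume Q * MG := by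
        rw [hQvol]
        exact setLIntegral_cube_le _ (by positivity) hxQ
      have hG1 : ∫⁻ z in Q, ‖S (hF1.toLp _) z‖ₑ ^ 2 ≤
          volume Q * (ENNReal.ofReal B ^ 2 * (4 * n) ^ n * MF) := by
        calc ∫⁻ z in Q, ‖S (hF1.toLp _) z‖ₑ ^ 2 ≤ ∫⁻ z, ‖S (hF1.toLp _) z‖ₑ ^ 2 :=
              setLIntegral_le_lintegral _ _
          _ ≤ ENNReal.ofReal B ^ 2 * ∫⁻ z, ‖P.indicator F z‖ₑ ^ 2 :=
              lintegral_enorm_apply_sq_le hS hF1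
          _ = ENNReal.ofReal B ^ 2 * ∫⁻ z in P, ‖F z‖ₑ ^ 2 := by
              rw [← lintegral_indicator hPm]
              congr 2 with z
              by_cases hz : z ∈ P <;> simp [hz]
          _ ≤ ENNReal.ofReal B ^ 2 * (ENNReal.ofReal (2 * δ) ^ n * MF) := by
              gcongr
              exact setLIntegral_closedBall_le _ hδ (by simp [hδ.le])
          _ = _ := by
              -- The cube around `P` is `(4 * n) ^ n` times as large as `Q`.
              have : 2 * δ = 2 * r * (4 * n : NNReal) := by
                rw [hr]; push_cast; field_simp
              rw [this, hQvol, ENNReal.ofReal_mul (by positivity), ENNReal.ofReal_coe_nnreal]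
              push_cast
              ring
      have ha2 : a ^ 2 ≤ (ENNReal.ofReal A * decayConst n ε) ^ 2 * MF := by
        rw [ha, mul_pow]
        gcongr
        exact maxFn_sq_le hF.1.enorm x
      calc volume Q * ‖truncatedIntegral K δ F x‖ₑ ^ 2
          = ∫⁻ _ in Q, ‖truncatedIntegral K δ F x‖ₑ ^ 2 := by
            rw [setLIntegral_const, mul_comm]
        _ ≤ ∫⁻ z in Q, 3 * (a ^ 2 + ‖S (hF2.toLp F) z‖ₑ ^ 2 + ‖S (hF1.toLp _) z‖ₑ ^ 2) :=
            lintegral_mono_ae ((ae_restrict_iff' hQm).2 hpt)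
        _ = 3 * (volume Q * a ^ 2 + (∫⁻ z in Q, ‖S (hF2.toLp F) z‖ₑ ^ 2) +
            ∫⁻ z in Q, ‖S (hF1.toLp _) z‖ₑ ^ 2) := by
            rw [lintegral_const_mul' _ _ (by norm_num), lintegral_add_left' (hmG.const_add _),
              lintegral_add_left' aemeasurable_const, setLIntegral_const, mul_comm (a ^ 2)]
        _ ≤ 3 * (volume Q * ((ENNReal.ofReal A * decayConst n ε) ^ 2 * MF) + volume Q * MG +
            volume Q * (ENNReal.ofReal B ^ 2 * (4 * n) ^ n * MF)) := by gcongr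
        _ = volume Q * (3 * (((ENNReal.ofReal A * decayConst n ε) ^ 2 +
            ENNReal.ofReal B ^ 2 * (4 * n) ^ n) * MF + 1 * MG)) := by ring
        _ ≤ volume Q * (3 * (((ENNReal.ofReal A * decayConst n ε) ^ 2 + 1 +
            ENNReal.ofReal B ^ 2 * (4 * n) ^ n) * MF +
            ((ENNReal.ofReal A * decayConst n ε) ^ 2 + 1 +
            ENNReal.ofReal B ^ 2 * (4 * n) ^ n) * MG)) := by
            gcongr
            · exact le_self_add
            · exact le_add_right le_add_self
        _ = _ := by rw [cotlarConst]; ring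
    exact (ENNReal.mul_le_mul_iff_right hQ0 hQtop).1 hint
  have key' : maximalSingularIntegral K F x ≤ (cotlarConst n A ε B * (MF + MG)) ^ (1 / 2 : ℝ) := by
    refine iSup_le fun δ => iSup_le fun hδ => ?_
    have h := ENNReal.rpow_le_rpow (key δ hδ) (z := 1 / 2) (by norm_num)
    rw [← ENNReal.rpow_natCast, ← ENNReal.rpow_mul] at h
    simpa using h
  calc _ ≤ ((cotlarConst n A ε B * (MF + MG)) ^ (1 / 2 : ℝ)) ^ 2 := by gcongr
    _ = _ := by rw [← ENNReal.rpow_natCast, ← ENNReal.rpow_mul]; norm_num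

/-- The constant in the weak-type `(2,2)` inequality. -/
noncomputable def weakTwoConst (n : ℕ) (A ε B : ℝ) : ℝ≥0∞ :=
  2 * cotlarConst n A ε B * (5 ^ n * (1 + ENNReal.ofReal B ^ 2))

lemma weakTwoConst_ne_top (n : ℕ) (A B : ℝ) {ε : ℝ} (hε : 0 < ε) : weakTwoConst n A ε B ≠ ∞ := by
  have := cotlarConst_ne_top n A B hε
  unfold weakTwoConst
  finiteness

/-- The maximal singular integral is of weak type `(2,2)`. -/
theorem sq_mul_volume_lt_maximalSingularIntegral_le (hn : 1 ≤ n) (hK : IsStandardKernel K A ε)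
    (hA : 0 ≤ A) (hε : 0 < ε)
    {S : Lp ℂ 2 (volume : Measure (Rn n)) →L[ℂ] Lp ℂ 2 (volume : Measure (Rn n))}
    (hS : ‖S‖ ≤ B) (hrep : RepresentedBy S K) {F : Rn n → ℂ} (hF : Integrable F)
    (hF2 : MemLp F 2 volume) (lam : ℝ≥0∞) :
    lam ^ 2 * volume {x | lam < maximalSingularIntegral K F x} ≤
      weakTwoConst n A ε B * ∫⁻ x, ‖F x‖ₑ ^ 2 := by
  set C := 2 * cotlarConst n A ε B with hC
  have hC0 : C ≠ 0 := mul_ne_zero (by norm_num) (cotlarConst_ne_zero n A B ε)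
  have hCtop : C ≠ ∞ := ENNReal.mul_ne_top (by norm_num) (cotlarConst_ne_top n A B hε)
  set κ := lam ^ 2 / C with hκ
  have hκC : C * κ = lam ^ 2 := ENNReal.mul_div_cancel hC0 hCtop
  have hsub : {x | lam < maximalSingularIntegral K F x} ⊆
      {x | κ < maxFn (fun y => ‖F y‖ₑ ^ 2) x} ∪
        {x | κ < maxFn (fun y => ‖S (hF2.toLp F) y‖ₑ ^ 2) x} := by
    intro x hx
    by_contra hcon
    simp only [Set.mem_union, Set.mem_ofPred_eq, not_or, not_lt] at hcon hx
    have h := maximalSingularIntegral_sq_le hn hK hA hε hS hrep hF hF2 x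
    have h2 : cotlarConst n A ε B * (maxFn (fun y => ‖F y‖ₑ ^ 2) x +
        maxFn (fun y => ‖S (hF2.toLp F) y‖ₑ ^ 2) x) ≤ lam ^ 2 := by
      calc _ ≤ cotlarConst n A ε B * (κ + κ) := by gcongr; exacts [hcon.1, hcon.2]
        _ = C * κ := by rw [hC]; ring
        _ = lam ^ 2 := hκC
    exact absurd ((ENNReal.pow_lt_pow_left two_ne_zero hx).trans_le (h.trans h2)) (lt_irrefl _)
  calc lam ^ 2 * volume {x | lam < maximalSingularIntegral K F x}
      ≤ C * (κ * volume {x | κ < maxFn (fun y => ‖F y‖ₑ ^ 2) x} +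
        κ * volume {x | κ < maxFn (fun y => ‖S (hF2.toLp F) y‖ₑ ^ 2) x}) := by
        rw [← mul_add, ← mul_assoc, hκC]
        gcongr
        exact (measure_mono hsub).trans (measure_union_le _ _)
    _ ≤ C * (5 ^ n * (∫⁻ x, ‖F x‖ₑ ^ 2) +
        5 ^ n * (ENNReal.ofReal B ^ 2 * ∫⁻ x, ‖F x‖ₑ ^ 2)) := by
        refine mul_le_mul_right (add_le_add (mul_volume_lt_maxFn_le hn _ κ) ?_) _
        · refine (mul_volume_lt_maxFn_le hn _ κ).trans ?_
          gcongr
          exact lintegral_enorm_apply_sq_le hS hF2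
    _ = _ := by rw [weakTwoConst]; ring

end cotlar

/-! ### Calderón–Zygmund decomposition and the weak type (1,1) -/

section weakType

variable {n : ℕ} {K : Rn n → Rn n → ℂ} {A ε B : ℝ}

/-- Replacing a function by its averages on disjoint cubes. -/
lemma exists_goodPart {s : Set (Rn n × ℝ)} (hdisj : s.PairwiseDisjoint fun q => ocube q.1 q.2)
    (F : Rn n → ℂ) :
    ∃ g : Rn n → ℂ, (∀ q ∈ s, ∀ x ∈ ocube q.1 q.2, g x = ⨍ y in ocube q.1 q.2, F y) ∧
      ∀ x ∉ (⋃ q ∈ s, ocube q.1 q.2), g x = F x := by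
  classical
  refine ⟨fun x => if h : ∃ q ∈ s, x ∈ ocube q.1 q.2 then ⨍ y in ocube h.choose.1 h.choose.2, F y
    else F x, fun q hq x hx => ?_, fun x hx => ?_⟩
  · have h : ∃ q ∈ s, x ∈ ocube q.1 q.2 := ⟨q, hq, hx⟩
    have heq : h.choose = q := hdisj.elim_set h.choose_spec.1 hq x h.choose_spec.2 hx
    simp only [dif_pos h, heq]
  · have h : ¬ ∃ q ∈ s, x ∈ ocube q.1 q.2 := by
      simpa using hx
    simp only [dif_neg h]

/-- The Calderón--Zygmund decomposition of an integrable function at height `lam`. -/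
theorem exists_calderonZygmund_decomposition (hn : 1 ≤ n) {F : Rn n → ℂ} (hF : Integrable F)
    {lam : ℝ≥0∞} (h0 : lam ≠ 0) (htop : lam ≠ ∞) :
    ∃ (s : Set (Rn n × ℝ)) (g b : Rn n → ℂ), s.Countable ∧ (∀ q ∈ s, 0 < q.2) ∧
      s.PairwiseDisjoint (fun q => ocube q.1 q.2) ∧
      lam * ∑' q : s, ENNReal.ofReal q.1.2 ^ n ≤ ∫⁻ x, ‖F x‖ₑ ∧
      Integrable g ∧ Integrable b ∧ F = g + b ∧
      (∀ᵐ x, ‖g x‖ₑ ≤ 2 ^ n * lam) ∧ ∫⁻ x, ‖g x‖ₑ ≤ ∫⁻ x, ‖F x‖ₑ ∧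
      (∀ q ∈ s, ∫ x in ocube q.1 q.2, b x = 0) ∧
      (∀ x ∉ (⋃ q ∈ s, ocube q.1 q.2), b x = 0) := by
  have hI : ∫⁻ x, ‖F x‖ₑ ≠ ∞ := hF.2.ne
  obtain ⟨s, hsc, hpos, hdisj, hlow, hup, hae⟩ := exists_stopping_cubes hn hF.1.enorm htop
    -- A side so large that no initial cell can be bad; the maximum with `1` gives `ℓ ≤ ℓ ^ n`.
    (ℓ := max 1 ((∫⁻ x, ‖F x‖ₑ) / lam).toReal) (by positivity) (by
      have h1 : (∫⁻ x, ‖F x‖ₑ) / lam ≤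
          ENNReal.ofReal (max 1 ((∫⁻ x, ‖F x‖ₑ) / lam).toReal) :=
        (ENNReal.le_ofReal_iff_toReal_le (ENNReal.div_ne_top hI h0) (by positivity)).2
          (le_max_right _ _)
      calc ∫⁻ x, ‖F x‖ₑ = lam * ((∫⁻ x, ‖F x‖ₑ) / lam) := (ENNReal.mul_div_cancel h0 htop).symm
        _ ≤ _ := by
          gcongr
          exact h1.trans (le_self_pow₀ (by simp) (by omega)))
  obtain ⟨g, hgs, hgc⟩ := exists_goodPart hdisj F
  set Ω := ⋃ q ∈ s, ocube q.1 q.2 with hΩ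
  have hΩm : MeasurableSet Ω := MeasurableSet.biUnion hsc fun q _ => measurableSet_ocube _ _
  have hvol0 : ∀ q ∈ s, ENNReal.ofReal q.2 ^ n ≠ 0 := fun q hq =>
    pow_ne_zero _ (by simpa using hpos q hq)
  have havg : ∀ q ∈ s, ENNReal.ofReal q.2 ^ n * ‖⨍ y in ocube q.1 q.2, F y‖ₑ ≤
      ∫⁻ y in ocube q.1 q.2, ‖F y‖ₑ := fun q hq => by
    rw [setAverage_eq, enorm_smul, measureReal_def, volume_ocube, ← mul_assoc,
      Real.enorm_eq_ofReal (by positivity), ENNReal.ofReal_inv_of_pos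
        (ENNReal.toReal_pos (hvol0 q hq) (by finiteness)), ENNReal.ofReal_toReal (by finiteness),
      ENNReal.mul_inv_cancel (hvol0 q hq) (by finiteness), one_mul]
    exact enorm_integral_le_lintegral_enorm _
  have hgint : ∀ q ∈ s, ∫⁻ x in ocube q.1 q.2, ‖g x‖ₑ ≤ ∫⁻ x in ocube q.1 q.2, ‖F x‖ₑ :=
    fun q hq => by
      refine le_trans (le_of_eq ?_) (havg q hq)
      rw [setLIntegral_congr_fun (measurableSet_ocube _ _)
        (fun x hx => by simp only [hgs q hq x hx] : Set.EqOn (fun x => ‖g x‖ₑ)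
          (fun _ => ‖⨍ y in ocube q.1 q.2, F y‖ₑ) (ocube q.1 q.2)), setLIntegral_const,
        volume_ocube, mul_comm]
  have hgm : AEStronglyMeasurable g volume := by
    have h1 : AEStronglyMeasurable g (volume.restrict Ω) := by
      have := hsc.to_subtype
      rw [hΩ, Set.biUnion_eq_iUnion]
      refine AEStronglyMeasurable.iUnion fun q => ?_
      refine (aestronglyMeasurable_const (b := ⨍ y in ocube q.1.1 q.1.2, F y)).congr ?_
      filter_upwards [ae_restrict_mem (measurableSet_ocube _ _)] with x hx
      exact (hgs q q.2 x hx).symm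
    have h2 : AEStronglyMeasurable g (volume.restrict Ωᶜ) := by
      refine hF.1.restrict.congr ?_
      filter_upwards [ae_restrict_mem hΩm.compl] with x hx
      exact (hgc x hx).symm
    have h3 := aestronglyMeasurable_union_iff.2 ⟨h1, h2⟩
    rwa [Set.union_compl_self, Measure.restrict_univ] at h3
  have hgle : ∫⁻ x, ‖g x‖ₑ ≤ ∫⁻ x, ‖F x‖ₑ := by
    rw [← lintegral_add_compl _ hΩm, ← lintegral_add_compl (fun x => ‖F x‖ₑ) hΩm]
    refine add_le_add ?_ (le_of_eq ?_)
    · rw [hΩ, lintegral_biUnion hsc (fun q _ => measurableSet_ocube _ _) hdisj,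
        lintegral_biUnion hsc (fun q _ => measurableSet_ocube _ _) hdisj]
      exact ENNReal.tsum_le_tsum fun q => hgint q q.2
    · refine setLIntegral_congr_fun hΩm.compl fun x hx => ?_
      simp only [hgc x hx]
  have hgi : Integrable g := ⟨hgm, hgle.trans_lt hI.lt_top⟩
  refine ⟨s, g, F - g, hsc, hpos, hdisj, ?_, hgi, hF.sub hgi, by simp, ?_, hgle, fun q hq => ?_,
    fun x hx => by simp [hgc x hx]⟩
  · rw [← ENNReal.tsum_mul_left]
    calc _ ≤ ∑' q : s, ∫⁻ y in ocube q.1.1 q.1.2, ‖F y‖ₑ :=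
          ENNReal.tsum_le_tsum fun q => (hlow q q.2).le
      _ = ∫⁻ y in Ω, ‖F y‖ₑ := by
          rw [hΩ, lintegral_biUnion hsc (fun q _ => measurableSet_ocube _ _) hdisj]
      _ ≤ _ := setLIntegral_le_lintegral _ _
  · filter_upwards [hae] with x hx
    by_cases hxΩ : x ∈ Ω
    · obtain ⟨q, hq, hxq⟩ := Set.mem_iUnion₂.1 hxΩ
      rw [hgs q hq x hxq]
      refine (ENNReal.mul_le_mul_iff_right (hvol0 q hq) (by finiteness)).1 ?_
      refine (havg q hq).trans ((hup q hq).trans (le_of_eq ?_))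
      ring
    · rw [hgc x hxΩ]
      refine (hx hxΩ).trans (le_mul_of_one_le_left' ?_)
      exact one_le_pow₀ one_le_two
  · simp only [Pi.sub_apply]
    rw [integral_sub hF.integrableOn hgi.integrableOn,
      setIntegral_congr_fun (measurableSet_ocube _ _) (hgs q hq), setIntegral_const,
      setAverage_eq, smul_smul, measureReal_def, volume_ocube, mul_inv_cancel₀, one_smul, sub_self]
    exact (ENNReal.toReal_pos (hvol0 q hq) (by finiteness)).ne'

/-- The bound for the contribution of a single cube `q` to the bad part, far from `q`. -/
noncomputable def cubeTail (n : ℕ) (A ε : ℝ) (b : Rn n → ℂ) (q : Rn n × ℝ) (x : Rn n) : ℝ≥0∞ :=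
  ENNReal.ofReal A * (ENNReal.ofReal ((n * q.2) ^ ε / ‖q.1 - x‖ ^ ((n : ℝ) + ε)) *
    ∫⁻ y in ocube q.1 q.2, ‖b y‖ₑ)

/-- Either the cube lies wholly in the truncation region, where the mean zero of `b` brings in the
smoothness of the kernel, or some point of it is within `δ` of `x`; then its truncated part lies in
an annulus, because the cube is small compared with its distance from `x`. -/
lemma IsStandardKernel.enorm_setIntegral_cube_le (hn : 1 ≤ n) (hK : IsStandardKernel K A ε)
    (hA : 0 ≤ A) (hε : 0 < ε) {b : Rn n → ℂ} (hb : Integrable b) {q : Rn n × ℝ} (hq : 0 < q.2)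
    (hbq : ∫ y in ocube q.1 q.2, b y = 0) {x : Rn n}
    (hx : x ∉ Metric.closedBall q.1 (4 * (n * q.2))) {δ : ℝ} (hδ : 0 < δ) :
    ‖∫ y in ocube q.1 q.2 ∩ {y | δ < ‖x - y‖}, K x y * b y‖ₑ ≤ cubeTail n A ε b q x +
      ∫⁻ y in ocube q.1 q.2 ∩ {y | 3 * δ / 4 ≤ ‖x - y‖ ∧ ‖x - y‖ ≤ 2 * (3 * δ / 4)},
        ‖K x y * b y‖ₑ := by
  have hn0 : (0 : ℝ) < n := by exact_mod_cast hn
  set D := n * q.2 with hD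
  have hDpos : 0 < D := by positivity
  set Q := ocube q.1 q.2 with hQ
  have hQm : MeasurableSet Q := measurableSet_ocube _ _
  have hdiam : ∀ y ∈ Q, ∀ z ∈ Q, ‖y - z‖ ≤ D := fun y hy z hz =>
    norm_sub_le_of_mem_cube (ocube_subset_cube _ _ hy) (ocube_subset_cube _ _ hz)
  have hcor : q.1 ∈ Q := fun i => by simp [hq]
  rw [Metric.mem_closedBall, dist_eq_norm, not_le] at hx
  have hfar : ∀ y ∈ Q, 3 * D < ‖x - y‖ := fun y hy => by
    have h1 := norm_sub_le_norm_sub_add_norm_sub x y q.1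
    have h2 := hdiam y hy q.1 hcor
    linarith
  by_cases hall : ∀ y ∈ Q, δ < ‖x - y‖
  · rw [Set.inter_eq_left.2 (show Q ⊆ {y | δ < ‖x - y‖} from hall)]
    refine le_add_right ?_
    have h1 : ∫ y in Q, K x y * b y = ∫ y in Q, (K x y - K x q.1) * b y := by
      simp only [sub_mul]
      rw [integral_sub, integral_const_mul, hbq, mul_zero, sub_zero]
      · exact hK.integrableOn hA hε hQm hδ (fun y hy => (hall y hy).le) hb
      · exact hb.integrableOn.const_mul _
    rw [h1]
    refine (enorm_integral_le_lintegral_enorm _).trans ?_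
    rw [cubeTail, ← lintegral_const_mul' _ _ ENNReal.ofReal_ne_top,
      ← lintegral_const_mul' _ _ ENNReal.ofReal_ne_top]
    refine setLIntegral_mono' hQm fun y hy => ?_
    rw [enorm_mul, ← mul_assoc, ← ENNReal.ofReal_mul hA]
    gcongr
    rw [← ofReal_norm, norm_sub_rev]
    apply ENNReal.ofReal_le_ofReal
    have hd := hdiam q.1 hcor y hy
    rw [norm_sub_rev] at hx
    have h := hK.regularity q.1 x y (by linarith)
    calc ‖K x q.1 - K x y‖ ≤ A * ‖q.1 - y‖ ^ ε / ‖q.1 - x‖ ^ ((n : ℝ) + ε) := by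
          linarith [norm_nonneg (K q.1 x - K y x)]
      _ ≤ A * D ^ ε / ‖q.1 - x‖ ^ ((n : ℝ) + ε) := by gcongr
      _ = _ := by ring
  -- Here `‖x - y‖ ≤ δ + D` while `3D < ‖x - y‖`, which gives `‖x - y‖ < 3δ/2`.
  · push Not at hall
    obtain ⟨y₀, hy₀, hy₀δ⟩ := hall
    refine le_add_left ((enorm_integral_le_lintegral_enorm _).trans (lintegral_mono_set ?_))
    rintro y ⟨hy, hyδ⟩
    have hyδ' : δ < ‖x - y‖ := hyδ
    refine ⟨hy, by linarith, ?_⟩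
    have h1 := norm_sub_le_norm_sub_add_norm_sub x y₀ y
    have h2 := hdiam y₀ hy₀ y hy
    have h3 := hfar y hy
    linarith

/-- Off the dilated cubes, the maximal singular integral of the bad part is controlled by the tails
of the cubes and the maximal function. -/
theorem IsStandardKernel.maximalSingularIntegral_badPart_le (hn : 1 ≤ n)
    (hK : IsStandardKernel K A ε) (hA : 0 ≤ A) (hε : 0 < ε) {b : Rn n → ℂ} (hb : Integrable b)
    {s : Set (Rn n × ℝ)} (hsc : s.Countable) (hpos : ∀ q ∈ s, 0 < q.2)
    (hdisj : s.PairwiseDisjoint (fun q => ocube q.1 q.2))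
    (hbq : ∀ q ∈ s, ∫ x in ocube q.1 q.2, b x = 0)
    (hb0 : ∀ x ∉ (⋃ q ∈ s, ocube q.1 q.2), b x = 0) {x : Rn n}
    (hx : x ∉ ⋃ q ∈ s, Metric.closedBall q.1 (4 * (n * q.2))) :
    maximalSingularIntegral K b x ≤ (∑' q : s, cubeTail n A ε b q x) +
      ENNReal.ofReal (A * (2 * 2) ^ n) * maxFn (fun y => ‖b y‖ₑ) x := by
  have := hsc.to_subtype
  refine iSup_le fun δ => iSup_le fun hδ => ?_
  set N : Set (Rn n) := {y | 3 * δ / 4 ≤ ‖x - y‖ ∧ ‖x - y‖ ≤ 2 * (3 * δ / 4)} with hN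
  have hm : Measurable fun y : Rn n => ‖x - y‖ := by fun_prop
  have hNm : MeasurableSet N := (measurableSet_le measurable_const hm).inter
    (measurableSet_le hm measurable_const)
  have hTm := measurableSet_lt_norm_sub (n := n) x δ
  have hQm : ∀ q : s, MeasurableSet (ocube q.1.1 q.1.2 ∩ {y | δ < ‖x - y‖}) := fun q =>
    (measurableSet_ocube _ _).inter hTm
  have hQd : Pairwise (Function.onFun Disjoint
      fun q : s => ocube q.1.1 q.1.2 ∩ {y | δ < ‖x - y‖}) := fun p q hpq =>
    (hdisj p.2 q.2 fun h => hpq (Subtype.ext h)).mono Set.inter_subset_left Set.inter_subset_left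
  have hint := hK.integrableOn hA hε hTm hδ (fun y hy => le_of_lt hy) hb
  have hU : (⋃ q : s, ocube q.1.1 q.1.2 ∩ {y | δ < ‖x - y‖}) ⊆ {y | δ < ‖x - y‖} :=
    Set.iUnion_subset fun q => Set.inter_subset_right
  have h1 : truncatedIntegral K δ b x =
      ∑' q : s, ∫ y in ocube q.1.1 q.1.2 ∩ {y | δ < ‖x - y‖}, K x y * b y := by
    rw [← integral_iUnion hQm hQd (hint.mono_set hU), truncatedIntegral]
    refine setIntegral_eq_of_subset_of_forall_sdiff_eq_zero hTm hU fun y hy => ?_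
    rw [hb0 y, mul_zero]
    intro hyU
    obtain ⟨q, hq, hyq⟩ := Set.mem_iUnion₂.1 hyU
    exact hy.2 (Set.mem_iUnion.2 ⟨⟨q, hq⟩, hyq, hy.1⟩)
  rw [h1]
  refine enorm_tsum_le_tsum_enorm.trans ?_
  have hx' : ∀ q ∈ s, x ∉ Metric.closedBall q.1 (4 * (n * q.2)) := fun q hq hxq =>
    hx (Set.mem_biUnion hq hxq)
  refine (ENNReal.tsum_le_tsum fun q : s => hK.enorm_setIntegral_cube_le hn hA hε hb
    (hpos q q.2) (hbq q q.2) (hx' q q.2) hδ).trans ?_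
  rw [ENNReal.tsum_add]
  gcongr
  -- The cubes are disjoint, so all boundary terms together are at most one integral over the
  -- annulus `N`.
  rw [← lintegral_iUnion (fun q : s => (measurableSet_ocube _ _).inter hNm)
    (fun p q hpq => (hdisj p.2 q.2 fun h => hpq (Subtype.ext h)).mono Set.inter_subset_left
      Set.inter_subset_left)]
  refine (lintegral_mono_set (Set.iUnion_subset fun q => Set.inter_subset_right)).trans ?_
  exact hK.setLIntegral_annulus_le hA hNm (by positivity) two_pos (fun y hy => hy)
    (by simp; positivity) b

lemma measurable_cubeTail (b : Rn n → ℂ) (q : Rn n × ℝ) : Measurable (cubeTail n A ε b q) := by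
  unfold cubeTail
  fun_prop

/-- The tail of a cube is integrable away from the cube. -/
lemma setLIntegral_cubeTail_le (hn : 1 ≤ n) (hε : 0 < ε) (b : Rn n → ℂ) {q : Rn n × ℝ}
    (hq : 0 < q.2) {V : Set (Rn n)} (hV : ∀ x ∈ V, x ∉ Metric.closedBall q.1 (4 * (n * q.2))) :
    ∫⁻ x in V, cubeTail n A ε b q x ≤
      ENNReal.ofReal A * decayConst n ε * ∫⁻ y in ocube q.1 q.2, ‖b y‖ₑ := by
  have hn0 : (0 : ℝ) < n := by exact_mod_cast hn
  have hD : 0 < n * q.2 := by positivity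
  have hsub : V ⊆ {x | n * q.2 < ‖q.1 - x‖} := fun x hx => by
    have := hV x hx
    rw [Metric.mem_closedBall, dist_comm, dist_eq_norm, not_le] at this
    show n * q.2 < ‖q.1 - x‖
    linarith
  refine (lintegral_mono_set hsub).trans ?_
  unfold cubeTail
  rw [lintegral_const_mul' _ _ ENNReal.ofReal_ne_top, lintegral_mul_const _ (by fun_prop),
    mul_assoc]
  gcongr
  -- The integral in `x` of the tail around the corner is the decay estimate for the constant
  -- function.
  have h := setLIntegral_decay_le (fun _ : Rn n => 1) hε hD (x := q.1) (p := q.1)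
    (by simp [hD.le])
  simp only [mul_one] at h
  refine h.trans ((mul_le_mul_right (maxFn_const_le 1 q.1) _).trans ?_)
  rw [mul_one]

lemma mul_volume_div_lt_maxFn_le (hn : 1 ≤ n) (u : Rn n → ℝ≥0∞) (lam : ℝ≥0∞) {C : ℝ≥0∞}
    (h0 : C ≠ 0) (htop : C ≠ ∞) :
    lam * volume {x | lam / C < maxFn u x} ≤ C * 5 ^ n * ∫⁻ x, u x := by
  have h := mul_volume_lt_maxFn_le hn u (lam / C)
  calc lam * volume {x | lam / C < maxFn u x}
      = C * (lam / C * volume {x | lam / C < maxFn u x}) := by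
        rw [← mul_assoc, ENNReal.mul_div_cancel h0 htop]
    _ ≤ C * (5 ^ n * ∫⁻ x, u x) := by gcongr
    _ = _ := by ring

lemma setLIntegral_tsum_cubeTail_le (hn : 1 ≤ n) (hε : 0 < ε) (b : Rn n → ℂ)
    {s : Set (Rn n × ℝ)} (hsc : s.Countable) (hpos : ∀ q ∈ s, 0 < q.2)
    (hdisj : s.PairwiseDisjoint (fun q => ocube q.1 q.2)) {V : Set (Rn n)}
    (hV : ∀ x ∈ V, ∀ q ∈ s, x ∉ Metric.closedBall q.1 (4 * (n * q.2))) :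
    ∫⁻ x in V, ∑' q : s, cubeTail n A ε b q x ≤
      ENNReal.ofReal A * decayConst n ε * ∫⁻ y, ‖b y‖ₑ := by
  have := hsc.to_subtype
  calc ∫⁻ x in V, ∑' q : s, cubeTail n A ε b q x
      = ∑' q : s, ∫⁻ x in V, cubeTail n A ε b q x :=
        lintegral_tsum fun q => (measurable_cubeTail b q.1).aemeasurable
    _ ≤ ∑' q : s, ENNReal.ofReal A * decayConst n ε * ∫⁻ y in ocube q.1.1 q.1.2, ‖b y‖ₑ :=
        ENNReal.tsum_le_tsum fun q => setLIntegral_cubeTail_le hn hε b (hpos q q.2)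
          fun x hx => hV x hx q q.2
    _ = ENNReal.ofReal A * decayConst n ε * ∫⁻ y in ⋃ q ∈ s, ocube q.1 q.2, ‖b y‖ₑ := by
        rw [ENNReal.tsum_mul_left, lintegral_biUnion hsc (fun q _ => measurableSet_ocube _ _)
          hdisj]
    _ ≤ _ := by gcongr; exact Measure.restrict_le_self

/-- The constant in the weak-type `(1,1)` inequality. -/
noncomputable def weakOneConst (n : ℕ) (A ε B : ℝ) : ℝ≥0∞ :=
  weakTwoConst n A ε B * 2 ^ n + (8 * n) ^ n + 2 * (ENNReal.ofReal A * decayConst n ε) +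
    2 * ((ENNReal.ofReal (A * (2 * 2) ^ n) + 1) * 5 ^ n)

lemma weakOneConst_ne_top (n : ℕ) (A B : ℝ) {ε : ℝ} (hε : 0 < ε) : weakOneConst n A ε B ≠ ∞ := by
  have := decayConst_ne_top n hε
  have := weakTwoConst_ne_top n A B hε
  unfold weakOneConst
  finiteness

/-- The maximal singular integral is of weak type `(1,1)`. -/
theorem mul_volume_lt_maximalSingularIntegral_le (hn : 1 ≤ n) (hK : IsStandardKernel K A ε)
    (hA : 0 ≤ A) (hε : 0 < ε)
    {S : Lp ℂ 2 (volume : Measure (Rn n)) →L[ℂ] Lp ℂ 2 (volume : Measure (Rn n))}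
    (hS : ‖S‖ ≤ B) (hrep : RepresentedBy S K) {F : Rn n → ℂ} (hF : Integrable F)
    {lam : ℝ≥0∞} (h0 : lam ≠ 0) (htop : lam ≠ ∞) :
    lam * volume {x | 3 * lam < maximalSingularIntegral K F x} ≤
      weakOneConst n A ε B * ∫⁻ x, ‖F x‖ₑ := by
  obtain ⟨s, g, b, hsc, hpos, hdisj, hvol, hg, hb, hFgb, hgle, hgint, hbq, hb0⟩ :=
    exists_calderonZygmund_decomposition hn hF h0 htop
  have := hsc.to_subtype
  set I := ∫⁻ x, ‖F x‖ₑ with hI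
  have hIg : ∫⁻ x, ‖g x‖ₑ ^ 2 ≤ 2 ^ n * lam * I := by
    calc ∫⁻ x, ‖g x‖ₑ ^ 2 ≤ ∫⁻ x, 2 ^ n * lam * ‖g x‖ₑ := by
          refine lintegral_mono_ae ?_
          filter_upwards [hgle] with x hx
          rw [sq]; gcongr
      _ = 2 ^ n * lam * ∫⁻ x, ‖g x‖ₑ := lintegral_const_mul' _ _ (by finiteness)
      _ ≤ _ := by gcongr
  have hg2 : MemLp g 2 volume := by
    refine ⟨hg.1, ?_⟩
    rw [eLpNorm_lt_top_iff_lintegral_rpow_enorm_lt_top (by simp) (by simp)]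
    have : 2 ^ n * lam * I < ∞ := by have := hF.2.ne; finiteness
    simpa using hIg.trans_lt this
  have hbint : ∫⁻ x, ‖b x‖ₑ ≤ 2 * I := by
    have hbeq : b = F - g := by rw [hFgb]; simp
    calc ∫⁻ x, ‖b x‖ₑ ≤ ∫⁻ x, ‖F x‖ₑ + ‖g x‖ₑ := by
          refine lintegral_mono fun x => ?_
          rw [hbeq]; exact enorm_sub_le (E := ℂ)
      _ = I + ∫⁻ x, ‖g x‖ₑ := lintegral_add_left' hF.1.enorm _
      _ ≤ 2 * I := by rw [two_mul]; gcongr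
  set U := ⋃ q ∈ s, Metric.closedBall q.1 (4 * (n * q.2)) with hU
  have hUm : MeasurableSet U := MeasurableSet.biUnion hsc fun q _ => measurableSet_closedBall
  -- The added `1` permits division by `C` even when `A = 0`.
  set C := ENNReal.ofReal (A * (2 * 2) ^ n) + 1 with hC
  have hC0 : C ≠ 0 := by simp [hC]
  have hCtop : C ≠ ∞ := by simp [hC]
  set H : Rn n → ℝ≥0∞ := fun x => ∑' q : s, cubeTail n A ε b q x with hH
  have hHm : Measurable H := Measurable.tsum fun q => measurable_cubeTail b q.1
  -- One `lam` each for the good part, the sum of tails and the maximal function of `b`. The tails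
  -- are cut off on `U` because they are integrated only away from the dilated cubes.
  have hsub : {x | 3 * lam < maximalSingularIntegral K F x} ⊆
      ({x | lam < maximalSingularIntegral K g x} ∪ U) ∪
        ({x | lam ≤ Uᶜ.indicator H x} ∪ {x | lam / C < maxFn (fun y => ‖b y‖ₑ) x}) := by
    intro x hx
    by_contra hcon
    simp only [Set.mem_union, Set.mem_ofPred_eq, not_or, not_lt, not_le] at hcon hx
    obtain ⟨⟨hc1, hc2⟩, hc3, hc4⟩ := hcon
    rw [Set.indicator_of_mem (by simpa using hc2)] at hc3
    have h1 := hK.maximalSingularIntegral_badPart_le hn hA hε hb hsc hpos hdisj hbq hb0 hc2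
    have h2 := hK.maximalSingularIntegral_add_le hA hε hg hb x
    rw [← hFgb] at h2
    have h3 : ENNReal.ofReal (A * (2 * 2) ^ n) * maxFn (fun y => ‖b y‖ₑ) x ≤ lam := by
      calc _ ≤ C * (lam / C) := by
            gcongr
            exact le_self_add
        _ = lam := ENNReal.mul_div_cancel hC0 hCtop
    refine absurd hx (not_lt.2 (h2.trans ?_))
    calc _ ≤ lam + (lam + lam) := add_le_add hc1 (h1.trans (add_le_add hc3.le h3))
      _ = 3 * lam := by ring
  have hv1 : lam * volume {x | lam < maximalSingularIntegral K g x} ≤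
      weakTwoConst n A ε B * 2 ^ n * I := by
    have h := sq_mul_volume_lt_maximalSingularIntegral_le hn hK hA hε hS hrep hg hg2 lam
    refine (ENNReal.mul_le_mul_iff_right h0 htop).1 ?_
    calc lam * (lam * volume {x | lam < maximalSingularIntegral K g x})
        = lam ^ 2 * volume {x | lam < maximalSingularIntegral K g x} := by ring
      _ ≤ weakTwoConst n A ε B * (2 ^ n * lam * I) := h.trans (by gcongr)
      _ = _ := by ring
  have hv2 : lam * volume U ≤ (8 * n) ^ n * I := by
    calc lam * volume U ≤ lam * ∑' q : s, (8 * n) ^ n * ENNReal.ofReal q.1.2 ^ n := by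
          gcongr
          refine (measure_biUnion_le volume hsc _).trans (ENNReal.tsum_le_tsum fun q => ?_)
          refine (measure_mono (closedBall_subset_centredCube _ _)).trans (le_of_eq ?_)
          rw [volume_centredCube, show 2 * (4 * (n * q.1.2)) = (8 * n : NNReal) * q.1.2 by
            push_cast; ring, ENNReal.ofReal_mul (by positivity), ENNReal.ofReal_coe_nnreal]
          push_cast
          ring
      _ = (8 * n) ^ n * (lam * ∑' q : s, ENNReal.ofReal q.1.2 ^ n) := by
          rw [ENNReal.tsum_mul_left]; ring
      _ ≤ _ := by gcongr
  have hv3 : lam * volume {x | lam ≤ Uᶜ.indicator H x} ≤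
      2 * (ENNReal.ofReal A * decayConst n ε) * I := by
    calc lam * volume {x | lam ≤ Uᶜ.indicator H x} ≤ ∫⁻ x, Uᶜ.indicator H x :=
          mul_meas_ge_le_lintegral (hHm.indicator hUm.compl) lam
      _ = ∫⁻ x in Uᶜ, H x := lintegral_indicator hUm.compl H
      _ ≤ ENNReal.ofReal A * decayConst n ε * ∫⁻ x, ‖b x‖ₑ :=
          setLIntegral_tsum_cubeTail_le hn hε b hsc hpos hdisj fun x hx q hq hxq =>
            hx (Set.mem_biUnion hq hxq)
      _ ≤ ENNReal.ofReal A * decayConst n ε * (2 * I) := by gcongr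
      _ = _ := by ring
  have hv4 : lam * volume {x | lam / C < maxFn (fun y => ‖b y‖ₑ) x} ≤ 2 * (C * 5 ^ n) * I := by
    refine (mul_volume_div_lt_maxFn_le hn (fun y => ‖b y‖ₑ) lam hC0 hCtop).trans ?_
    calc C * 5 ^ n * ∫⁻ x, ‖b x‖ₑ ≤ C * 5 ^ n * (2 * I) := by gcongr
      _ = _ := by ring
  calc _ ≤ lam * ((volume {x | lam < maximalSingularIntegral K g x} + volume U) +
        (volume {x | lam ≤ Uᶜ.indicator H x} +
          volume {x | lam / C < maxFn (fun y => ‖b y‖ₑ) x})) := by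
        gcongr
        refine (measure_mono hsub).trans ((measure_union_le _ _).trans ?_)
        gcongr <;> exact measure_union_le _ _
    _ ≤ (weakTwoConst n A ε B * 2 ^ n * I + (8 * n) ^ n * I) +
        (2 * (ENNReal.ofReal A * decayConst n ε) * I + 2 * (C * 5 ^ n) * I) := by
        rw [mul_add, mul_add, mul_add]
        exact add_le_add (add_le_add hv1 hv2) (add_le_add hv3 hv4)
    _ = _ := by rw [weakOneConst]; ring

end weakType

/-! ### The halving step and its iteration -/

section iteration

variable {n : ℕ} {K : Rn n → Rn n → ℂ} {A ε B : ℝ}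

/-- The size estimate at two points at distance one, which exist because `n ≥ 1`. -/
lemma IsStandardKernel.const_nonneg (hn : 1 ≤ n) (hK : IsStandardKernel K A ε) : 0 ≤ A := by
  set e : Rn n := EuclideanSpace.single ⟨0, hn⟩ 1 with he
  have hnorm : ‖e - 0‖ = 1 := by simp [he]
  have h := hK.size e 0 fun h => by simp [h] at hnorm
  rw [hnorm, one_pow, div_one] at h
  exact (norm_nonneg _).trans h

/-- The level, relative to the mean, above which the exceptional set is small. -/
noncomputable def levelConst (n : ℕ) (A ε B : ℝ) : ℝ≥0∞ :=
  (weakOneConst n A ε B + 5 ^ n) * (8 * n) ^ n * 2 ^ (n + 2)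

lemma levelConst_ne_top (n : ℕ) (A B : ℝ) {ε : ℝ} (hε : 0 < ε) : levelConst n A ε B ≠ ∞ := by
  have := weakOneConst_ne_top n A B hε
  unfold levelConst
  finiteness

lemma levelConst_ne_zero (hn : 1 ≤ n) (A ε B : ℝ) : levelConst n A ε B ≠ 0 := by
  have : n ≠ 0 := by omega
  simp [levelConst, this]

/-- The amount by which the level grows in each iteration step. -/
noncomputable def stepConst (n : ℕ) (A ε B : ℝ) : ℝ≥0∞ :=
  (3 + farConst n A ε) * levelConst n A ε B

lemma stepConst_ne_top (n : ℕ) (A B : ℝ) {ε : ℝ} (hε : 0 < ε) : stepConst n A ε B ≠ ∞ := by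
  have := levelConst_ne_top n A B hε
  have := farConst_ne_top n A hε
  unfold stepConst
  finiteness

lemma stepConst_ne_zero (hn : 1 ≤ n) (A ε B : ℝ) : stepConst n A ε B ≠ 0 :=
  mul_ne_zero (by simp) (levelConst_ne_zero hn A ε B)

/-- A set of small measure is covered, up to a null set, by cubes of small total volume, none of
which is contained in it. -/
lemma exists_cubes_of_volume_le (hn : 1 ≤ n) {E : Set (Rn n)} {ℓ : ℝ} (hℓ : 0 < ℓ)
    (hE : 2 ^ (n + 2) * volume E ≤ ENNReal.ofReal ℓ ^ n) :
    ∃ s : Set (Rn n × ℝ), s.Countable ∧ (∀ q ∈ s, 0 < q.2) ∧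
      ∑' q : s, ENNReal.ofReal q.1.2 ^ n ≤ 2⁻¹ * ENNReal.ofReal ℓ ^ n ∧
      (∀ q ∈ s, ∃ x ∈ cube q.1 q.2, x ∉ E) ∧ ∀ᵐ x, x ∈ E → x ∈ ⋃ q ∈ s, cube q.1 q.2 := by
  -- A measurable hull is used since `E` is not assumed measurable.
  set E' := toMeasurable volume E with hE'
  have hm : MeasurableSet E' := measurableSet_toMeasurable _ _
  have hvE : volume E' = volume E := measure_toMeasurable E
  have hEE' : E ⊆ E' := subset_toMeasurable _ _
  -- With this height `E'` fills at most `2 ^ n * θ = 1/2` of each stopping cube, so none is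
  -- contained in `E`, while the cubes have total volume at most `2 ^ (n + 1) * volume E`.
  set θ : ℝ≥0∞ := (2 ^ (n + 1))⁻¹ with hθ
  have hp0 : (2 : ℝ≥0∞) ^ (n + 1) ≠ 0 := by simp
  have hptop : (2 : ℝ≥0∞) ^ (n + 1) ≠ ∞ := by finiteness
  have hθm : 2 ^ (n + 1) * θ = 1 := ENNReal.mul_inv_cancel hp0 hptop
  have hθn : 2 ^ n * θ = 2⁻¹ := by
    have : (2 : ℝ≥0∞) * (2 ^ n * θ) = 1 := by rw [← hθm, pow_succ]; ring
    exact ENNReal.eq_inv_of_mul_eq_one_left (by rw [mul_comm]; exact this)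
  have hvol2 : 2 ^ (n + 1) * volume E' ≤ 2⁻¹ * ENNReal.ofReal ℓ ^ n := by
    rw [hvE]
    calc 2 ^ (n + 1) * volume E = 2⁻¹ * (2 ^ (n + 2) * volume E) := by
          rw [pow_succ _ (n + 1), mul_comm _ (2 : ℝ≥0∞), mul_assoc, ← mul_assoc 2⁻¹,
            ENNReal.inv_mul_cancel (by norm_num) (by norm_num), one_mul]
      _ ≤ _ := by gcongr
  have hint : ∫⁻ x, E'.indicator 1 x ≤ θ * ENNReal.ofReal ℓ ^ n := by
    rw [lintegral_indicator_one hm]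
    calc volume E' = θ * (2 ^ (n + 1) * volume E') := by
          rw [← mul_assoc, mul_comm θ, hθm, one_mul]
      _ ≤ θ * (2⁻¹ * ENNReal.ofReal ℓ ^ n) := by gcongr
      _ ≤ θ * (1 * ENNReal.ofReal ℓ ^ n) := by
          gcongr
          exact ENNReal.inv_le_one.2 one_le_two
      _ = _ := by rw [one_mul]
  obtain ⟨s, hsc, hpos, hdisj, hlow, hup, hae⟩ := exists_stopping_cubes hn
    ((measurable_one.indicator hm).aemeasurable) (ENNReal.inv_ne_top.2 hp0) hℓ hint
  have hcell : ∀ q : Rn n × ℝ, ∫⁻ y in ocube q.1 q.2, E'.indicator 1 y =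
      volume (E' ∩ ocube q.1 q.2) := fun q => by
    rw [lintegral_indicator_one hm, Measure.restrict_apply hm]
  refine ⟨s, hsc, hpos, ?_, fun q hq => ?_, ?_⟩
  · calc ∑' q : s, ENNReal.ofReal q.1.2 ^ n
        = 2 ^ (n + 1) * ∑' q : s, θ * ENNReal.ofReal q.1.2 ^ n := by
          rw [ENNReal.tsum_mul_left, ← mul_assoc, hθm, one_mul]
      _ ≤ 2 ^ (n + 1) * ∑' q : s, ∫⁻ y in ocube q.1.1 q.1.2, E'.indicator 1 y := by
          gcongr with q
          exact (hlow q q.2).le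
      _ = 2 ^ (n + 1) * ∫⁻ y in ⋃ q ∈ s, ocube q.1 q.2, E'.indicator 1 y := by
          rw [lintegral_biUnion hsc (fun q _ => measurableSet_ocube _ _) hdisj]
      _ ≤ 2 ^ (n + 1) * volume E' := by
          rw [← lintegral_indicator_one hm]
          exact mul_le_mul_right (setLIntegral_le_lintegral _ _) _
      _ ≤ _ := hvol2
  · by_contra! hcon
    have hsub : ocube q.1 q.2 ⊆ E' := fun x hx => hEE' (hcon x (ocube_subset_cube _ _ hx))
    have h := hup q hq
    rw [hcell, Set.inter_eq_right.2 hsub, volume_ocube, ← mul_assoc, hθn] at h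
    have h0 : ENNReal.ofReal q.2 ^ n ≠ 0 := pow_ne_zero _ (by simpa using hpos q hq)
    have h1 : ENNReal.ofReal q.2 ^ n ≠ ∞ := by finiteness
    rw [mul_comm, ← div_eq_mul_inv] at h
    exact absurd h (not_le.2 (ENNReal.half_lt_self h0 h1))
  · filter_upwards [hae] with x hx hxE
    by_contra hxU
    have h := hx fun h => hxU (Set.biUnion_mono subset_rfl (fun q _ => ocube_subset_cube _ _) h)
    rw [Set.indicator_of_mem (hEE' hxE), Pi.one_apply] at h
    refine absurd h (not_le.2 ?_)
    exact ENNReal.inv_lt_one.2 (ENNReal.one_lt_two.trans_le (le_self_pow₀ one_le_two (by omega)))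

/-- On a cube, the maximal singular integral of the localised function exceeds `k` times a fixed
multiple of the maximal function on a set of relative measure at most `2 ^ (-k)`. -/
theorem volume_stepConst_mul_maxFn_lt_le (hn : 1 ≤ n) (hK : IsStandardKernel K A ε) (hε : 0 < ε)
    {S : Lp ℂ 2 (volume : Measure (Rn n)) →L[ℂ] Lp ℂ 2 (volume : Measure (Rn n))}
    (hS : ‖S‖ ≤ B) (hrep : RepresentedBy S K) (k : ℕ) {F : Rn n → ℂ} (hF : Integrable F)
    (a : Rn n) {ℓ : ℝ} (hℓ : 0 < ℓ) :
    volume {x ∈ cube a ℓ | k * stepConst n A ε B * maxFn (fun y => ‖F y‖ₑ) x <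
        maximalSingularIntegral K ((Metric.closedBall a (4 * (n * ℓ))).indicator F) x} ≤
      (2⁻¹) ^ k * ENNReal.ofReal ℓ ^ n := by
  have hA := hK.const_nonneg hn
  have hn0 : (0 : ℝ) < n := by exact_mod_cast hn
  -- The hypothesis is applied to the truncated function on each of the smaller cubes.
  induction k generalizing F a ℓ with
  | zero =>
    rw [pow_zero, one_mul, ← volume_cube a ℓ]
    exact measure_mono fun x hx => hx.1
  | succ k ih =>
    set P := Metric.closedBall a (4 * (n * ℓ)) with hP
    set F' := P.indicator F with hF'
    have hPm : MeasurableSet P := measurableSet_closedBall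
    have hF'i : Integrable F' := hF.indicator hPm
    have hM : ∀ x, maxFn (fun y => ‖F' y‖ₑ) x ≤ maxFn (fun y => ‖F y‖ₑ) x := fun x =>
      maxFn_mono (Filter.Eventually.of_forall fun y => by
        by_cases hy : y ∈ P <;> simp [hF', hy]) x
    set I := ∫⁻ y, ‖F' y‖ₑ with hI
    have hItop : I ≠ ∞ := hF'i.2.ne
    -- The weak-type bound needs a nonzero level, so a vanishing localised function is treated
    -- separately.
    rcases eq_or_ne I 0 with hI0 | hI0
    · have hz : F' =ᵐ[volume] fun _ => 0 := by
        filter_upwards [(lintegral_eq_zero_iff' hF'i.1.enorm).1 hI0] with y hy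
        simpa using hy
      have hempty : ∀ x, maximalSingularIntegral K F' x = 0 := fun x => by
        rw [maximalSingularIntegral_congr_ae hz]
        simp [maximalSingularIntegral, truncatedIntegral]
      simp [hempty]
    set V := ENNReal.ofReal (2 * (4 * (n * ℓ))) ^ n with hV
    have hV0 : V ≠ 0 := pow_ne_zero _ (by simp only [ne_eq, ENNReal.ofReal_eq_zero, not_le]
                                          positivity)
    have hVtop : V ≠ ∞ := by finiteness
    have hVℓ : V = (8 * n) ^ n * ENNReal.ofReal ℓ ^ n := by
      rw [hV, show 2 * (4 * (n * ℓ)) = (8 * n : NNReal) * ℓ by push_cast; ring,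
        ENNReal.ofReal_mul (by positivity), ENNReal.ofReal_coe_nnreal]
      push_cast
      ring
    set μ := I / V with hμ
    have hμ0 : μ ≠ 0 := ENNReal.div_ne_zero.2 ⟨hI0, hVtop⟩
    have hμtop : μ ≠ ∞ := ENNReal.div_ne_top hItop hV0
    have hμI : I = μ * V := (ENNReal.div_mul_cancel hV0 hVtop).symm
    have ha : a ∈ cube a ℓ := fun i => ⟨le_rfl, by linarith⟩
    have hμM : ∀ x ∈ cube a ℓ, μ ≤ maxFn (fun y => ‖F' y‖ₑ) x := fun x hx => by
      refine ENNReal.div_le_of_le_mul ?_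
      have h1 : I = ∫⁻ y in P, ‖F' y‖ₑ := by
        refine (setLIntegral_eq_of_support_subset fun y hy => ?_).symm
        by_contra hyP
        exact hy (by simp [hF', hyP])
      rw [h1, mul_comm]
      have := norm_sub_le_of_mem_cube hx ha
      exact setLIntegral_closedBall_le _ (by positivity) (this.trans (by nlinarith))
    set Λ := levelConst n A ε B with hΛ
    have hΛ0 : Λ ≠ 0 := levelConst_ne_zero hn A ε B
    have hΛtop : Λ ≠ ∞ := levelConst_ne_top n A B hε
    have hl0 : Λ * μ ≠ 0 := mul_ne_zero hΛ0 hμ0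
    have hltop : Λ * μ ≠ ∞ := ENNReal.mul_ne_top hΛtop hμtop
    set E : Set (Rn n) := {x | 3 * (Λ * μ) < maximalSingularIntegral K F' x} ∪
      {x | Λ * μ < maxFn (fun y => ‖F' y‖ₑ) x} with hE
    have hEvol : 2 ^ (n + 2) * volume E ≤ ENNReal.ofReal ℓ ^ n := by
      have h1 := mul_volume_lt_maximalSingularIntegral_le hn hK hA hε hS hrep hF'i hl0 hltop
      have h2 := mul_volume_lt_maxFn_le hn (fun y => ‖F' y‖ₑ) (Λ * μ)
      have h3 : Λ * μ * volume E ≤ (weakOneConst n A ε B + 5 ^ n) * I := by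
        calc Λ * μ * volume E ≤ Λ * μ * (volume {x | 3 * (Λ * μ) < maximalSingularIntegral K F' x}
              + volume {x | Λ * μ < maxFn (fun y => ‖F' y‖ₑ) x}) := by
              gcongr; exact measure_union_le _ _
          _ ≤ weakOneConst n A ε B * I + 5 ^ n * I := by
              rw [mul_add]; exact add_le_add h1 h2
          _ = _ := by ring
      -- `levelConst` is made for this: `(8 * n) ^ n` is the ratio of `V` to `|Q|`, and `2 ^ (n +
      -- 2)` is the smallness that the covering lemma asks for.
      refine (ENNReal.mul_le_mul_iff_right hl0 hltop).1 ?_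
      calc Λ * μ * (2 ^ (n + 2) * volume E) = 2 ^ (n + 2) * (Λ * μ * volume E) := by ring
        _ ≤ 2 ^ (n + 2) * ((weakOneConst n A ε B + 5 ^ n) * I) := by gcongr
        _ = _ := by rw [hμI, hVℓ, hΛ, levelConst]; ring
    obtain ⟨s, hsc, hpos, hsum, hout, hcov⟩ := exists_cubes_of_volume_le hn hℓ hEvol
    have hgood : ∀ x ∉ E, maximalSingularIntegral K F' x ≤ 3 * (Λ * μ) ∧
        maxFn (fun y => ‖F' y‖ₑ) x ≤ Λ * μ := fun x hx => by
      simpa [hE] using hx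
    have hstep : 3 * Λ ≤ stepConst n A ε B := by
      rw [stepConst]; gcongr; exact le_self_add
    -- The cubes in `s` need not lie in `cube a ℓ`. The bound `μ ≤ M F'(x)` is only used at `x ∈
    -- cube a ℓ`, and the comparison point `x'` only needs to be outside `E`.
    have hkey : ∀ᵐ x, x ∈ {x ∈ cube a ℓ | ((k + 1 : ℕ) : ℝ≥0∞) * stepConst n A ε B *
        maxFn (fun y => ‖F y‖ₑ) x < maximalSingularIntegral K F' x} →
        x ∈ ⋃ q ∈ s, {x ∈ cube q.1 q.2 | k * stepConst n A ε B * maxFn (fun y => ‖F' y‖ₑ) x <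
          maximalSingularIntegral K ((Metric.closedBall q.1 (4 * (n * q.2))).indicator F') x} := by
      filter_upwards [hcov] with x hxcov ⟨hxQ, hx⟩
      have hx' := lt_of_le_of_lt (mul_le_mul_right (hM x)
        (((k + 1 : ℕ) : ℝ≥0∞) * stepConst n A ε B)) hx
      push_cast at hx'
      have hxE : x ∈ E := by
        by_contra hxE
        refine absurd hx' (not_lt.2 ((hgood x hxE).1.trans ?_))
        calc 3 * (Λ * μ) = 3 * Λ * μ := by ring
          _ ≤ stepConst n A ε B * maxFn (fun y => ‖F' y‖ₑ) x := by
              gcongr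
              exact hμM x hxQ
          _ ≤ _ := by
              gcongr
              exact le_mul_of_one_le_left' le_add_self
      obtain ⟨q, hq, hxq⟩ := Set.mem_iUnion₂.1 (hxcov hxE)
      refine Set.mem_biUnion hq ⟨hxq, ?_⟩
      by_contra! hcon
      obtain ⟨x', hx'q, hx'E⟩ := hout q hq
      have hfar := hK.maximalSingularIntegral_far_le hA hε hn (hpos q hq) hxq hx'q hF'i
      set R := Metric.closedBall q.1 (4 * (n * q.2)) with hR
      have hRm : MeasurableSet R := measurableSet_closedBall
      have hadd := hK.maximalSingularIntegral_add_le hA hε (hF'i.indicator hRm)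
        (hF'i.indicator hRm.compl) x
      rw [Set.indicator_self_add_compl] at hadd
      refine absurd hx' (not_lt.2 (hadd.trans ?_))
      -- The far part costs `(3 + farConst) Λ μ = stepConst * μ`, exactly one unit of the level
      -- after `μ ≤ M F'(x)`.
      calc _ ≤ k * stepConst n A ε B * maxFn (fun y => ‖F' y‖ₑ) x +
            (3 * (Λ * μ) + farConst n A ε * (Λ * μ)) := by
            refine add_le_add hcon (hfar.trans (add_le_add (hgood x' hx'E).1 ?_))
            exact mul_le_mul_right (hgood x' hx'E).2 _
        _ = k * stepConst n A ε B * maxFn (fun y => ‖F' y‖ₑ) x + stepConst n A ε B * μ := by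
            rw [stepConst]; ring
        _ ≤ k * stepConst n A ε B * maxFn (fun y => ‖F' y‖ₑ) x +
            stepConst n A ε B * maxFn (fun y => ‖F' y‖ₑ) x := by
            gcongr
            exact hμM x hxQ
        _ = _ := by ring
    calc _ ≤ volume (⋃ q ∈ s, {x ∈ cube q.1 q.2 | k * stepConst n A ε B *
          maxFn (fun y => ‖F' y‖ₑ) x < maximalSingularIntegral K
            ((Metric.closedBall q.1 (4 * (n * q.2))).indicator F') x}) := measure_mono_ae hkey
      _ ≤ ∑' q : s, (2⁻¹) ^ k * ENNReal.ofReal q.1.2 ^ n :=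
          (measure_biUnion_le volume hsc _).trans
            (ENNReal.tsum_le_tsum fun q => ih hF'i q.1.1 (hpos q q.2))
      _ ≤ (2⁻¹) ^ k * (2⁻¹ * ENNReal.ofReal ℓ ^ n) := by
          rw [ENNReal.tsum_mul_left]; gcongr
      _ = _ := by rw [pow_succ]; ring

end iteration

/-! ### From halving to exponential decay -/

theorem theorem2p2 (n : ℕ) (hn : 1 ≤ n) (A ε B : ℝ) (hε : 0 < ε) :
    ∃ c α : ℝ, 0 < c ∧ 0 < α ∧
      ∀ (T : SmoothCc n →ₗ[ℂ] (Rn n →ₘ[volume] ℂ)) (K : Rn n → Rn n → ℂ),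
        IsCalderonZygmund T K A ε B →
        ∀ (a : Rn n) (ℓ : ℝ), 0 < ℓ →
        ∀ f : Rn n → ℂ, MemLp f ∞ volume → (∀ᵐ x, x ∉ cube a ℓ → f x = 0) →
        ∀ t : ℝ, 0 < t →
          volume {x ∈ cube a ℓ |
              ENNReal.ofReal t * hlMaximal f x < maximalSingularIntegral K f x}
            ≤ ENNReal.ofReal (c * Real.exp (-α * t)) * volume (cube a ℓ) := by
  have hC0 := stepConst_ne_zero hn A ε B
  have hCtop := stepConst_ne_top n A B hε
  set C := (stepConst n A ε B).toReal with hC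
  have hCpos : 0 < C := ENNReal.toReal_pos hC0 hCtop
  have hlog : 0 < Real.log 2 := Real.log_pos one_lt_two
  -- With `k = ⌊t / C⌋₊` one has `t / C < k + 1`; the factor `2` pays for the rounding.
  refine ⟨2, Real.log 2 / C, two_pos, by positivity, ?_⟩
  intro T K hT a ℓ hℓ f hf hf0 t ht
  have hn0 : (0 : ℝ) < n := by exact_mod_cast hn
  have hK := hT.kernel
  obtain ⟨S, hS, hrep⟩ := hT.exists_representedBy (hK.const_nonneg hn) hε
  have ha : a ∈ cube a ℓ := fun i => ⟨le_rfl, by linarith⟩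
  have hind : (cube a ℓ).indicator f =ᵐ[volume] f := by
    filter_upwards [hf0] with x hx
    by_cases hxQ : x ∈ cube a ℓ
    · simp [hxQ]
    · simp [hxQ, hx hxQ]
  have hfi : Integrable f := by
    have : IsFiniteMeasure (volume.restrict (cube a ℓ)) :=
      ⟨by rw [Measure.restrict_apply_univ, volume_cube]; finiteness⟩
    have h1 : IntegrableOn f (cube a ℓ) := hf.restrict (cube a ℓ) |>.integrable le_top
    exact ((integrable_indicator_iff (measurableSet_cube a ℓ)).2 h1).congr hind
  -- The ball contains the cube, so localising `f` at the first stage changes nothing.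
  have hball : (Metric.closedBall a (4 * (n * ℓ))).indicator f =ᵐ[volume] f := by
    filter_upwards [hf0] with x hx
    by_cases hxB : x ∈ Metric.closedBall a (4 * (n * ℓ))
    · simp only [Set.indicator_of_mem hxB]
    · rw [Set.indicator_of_notMem hxB]
      refine (hx fun hxQ => hxB ?_).symm
      rw [Metric.mem_closedBall, dist_eq_norm]
      have : 0 < n * ℓ := by positivity
      linarith [norm_sub_le_of_mem_cube hxQ ha]
  set k := ⌊t / C⌋₊ with hk
  have hkt : (k : ℝ≥0∞) * stepConst n A ε B ≤ ENNReal.ofReal t := by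
    rw [← ENNReal.ofReal_toReal hCtop, ← hC, ← ENNReal.ofReal_natCast,
      ← ENNReal.ofReal_mul (by positivity)]
    refine ENNReal.ofReal_le_ofReal ?_
    rw [← le_div_iff₀ hCpos]
    exact Nat.floor_le (by positivity)
  have hexp : ((2 : ℝ≥0∞)⁻¹) ^ k ≤ ENNReal.ofReal (2 * Real.exp (-(Real.log 2 / C) * t)) := by
    have h1 : ((2 : ℝ≥0∞)⁻¹) ^ k = ENNReal.ofReal ((2⁻¹) ^ k) := by
      rw [ENNReal.ofReal_pow (by norm_num), ENNReal.ofReal_inv_of_pos two_pos]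
      simp
    rw [h1]
    refine ENNReal.ofReal_le_ofReal ?_
    have h2 : ((2 : ℝ)⁻¹) ^ k = 2 * Real.exp (-Real.log 2 * (k + 1)) := by
      rw [mul_add, Real.exp_add, mul_one, Real.exp_neg (Real.log 2), Real.exp_log two_pos,
        mul_comm (-Real.log 2), Real.exp_nat_mul, Real.exp_neg, Real.exp_log two_pos]
      ring
    rw [h2]
    refine mul_le_mul_of_nonneg_left (Real.exp_le_exp.2 ?_) zero_le_two
    have h3 : t / C < k + 1 := Nat.lt_floor_add_one _
    have h4 : -(Real.log 2 / C) * t = -Real.log 2 * (t / C) := by ring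
    rw [h4]
    nlinarith
  calc _ ≤ volume {x ∈ cube a ℓ | k * stepConst n A ε B * maxFn (fun y => ‖f y‖ₑ) x <
        maximalSingularIntegral K ((Metric.closedBall a (4 * (n * ℓ))).indicator f) x} := by
        refine measure_mono fun x ⟨hxQ, hx⟩ => ⟨hxQ, ?_⟩
        rw [maximalSingularIntegral_congr_ae hball]
        refine lt_of_le_of_lt ?_ hx
        rw [hlMaximal_eq_maxFn]
        gcongr
    _ ≤ (2⁻¹) ^ k * ENNReal.ofReal ℓ ^ n :=
        volume_stepConst_mul_maxFn_lt_le hn hK hε hS hrep k hfi a hℓ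
    _ ≤ _ := by
        rw [volume_cube]
        gcongr
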